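/- Conventions. All graphs have a finite vertex set $V$, and a graph on $V$ is a set $E$ of ordered pairs of vertices; an undirected edge $a-b$ is the two pairs $(a,b),(b,a)$, and a directed edge $a\to b$ is a pair $(a,b)\in E$ with $(b,a)\notin E$. The vertices stand for random variables (with finitely many values), and a joint distribution is Markov with respect to a DAG if every variable is independent of its non-descendants given its parents. Two DAGs on $V$ are Markov equivalent if the same joint distributions are Markov with respect to them; the essential graph of a DAG $D$ is the union of all DAGs Markov equivalent to $D$. For an undirected graph $G$, $MEC(G)$ is the set of all DAGs whose essential graph is $G$. An intervention family $\mathcal I$ is a set of subsets of $V$, and $D^{(I)}$ is obtained from $D$ by removing all edges directed towards vertices of $I$. A family of joint distributions $(P^{(I)})_{I\in\mathcal I\cup\{\emptyset\}}$ is generated by a DAG $D$ if each $P^{(I)}$ is Markov with respect to $D^{(I)}$ and, for all $I,J\in\mathcal I\cup\{\emptyset\}$ and every vertex $v\notin I\cup J$, the conditional distributions of $v$ given its parents in $D$ agree under $P^{(I)}$ and $P^{(J)}$ (wherever both are defined). Two DAGs are $\mathcal I$-Markov equivalent if they generate the same families. The $\mathcal I$-essential graph $\mathcal E_{\mathcal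 I}(D)$ is the union of all DAGs $\mathcal I$-Markov equivalent to $D$, and the intervention result space of $G$ is the set of graphs $\mathcal{IR}_{\mathcal I}(G)=\{\mathcal E_{\mathcal I}(D): D\in MEC(G)\}$. The set $\mathcal C(R)$ of chain components of a graph $R$ consists of the connected components (as undirected graphs) of what remains of $R$ after removing all its directed edges. Lemma. Let $G$ be an undirected chordal graph (UCCG) and let $\mathcal I$ be an arbitrary intervention family. Then $$|MEC(G)| = \sum_{R\in\mathcal{IR}_{\mathcal I}(G)}\ \prod_{C\in\mathcal C(R)} |MEC(C)| .$$ -/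

import Mathlib

namespace Causal

universe u

/-! ### Graphs -/

section Graphs

variable {V : Type u}

/-- An undirected graph is chordal if every (simple) cycle of length at least four has a chord:
an edge of the graph that joins two vertices of the cycle and is not an edge of the cycle. -/
def IsChordal (G : SimpleGraph V) : Prop :=
  ∀ (v : V) (c : G.Walk v v), c.IsCycle → 4 ≤ c.length →
    ∃ a ∈ c.support, ∃ b ∈ c.support, G.Adj a b ∧ s(a, b) ∉ c.edges

/-- An undirected graph seen as a graph with a set of ordered pairs as edges: an undirected edge
between `a` and `b` is the two pairs `(a, b)` and `(b, a)`. -/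
def ofUndirected (G : SimpleGraph V) : Digraph V where
  Adj := G.Adj

/-- A directed acyclic graph: no directed path of positive length returns to its start. -/
def IsDAG (D : Digraph V) : Prop :=
  ∀ v, ¬ Relation.TransGen D.Adj v v

/-- The parents of a vertex. -/
def parents (D : Digraph V) (v : V) : Set V :=
  {u | D.Adj u v}

/-- The non-descendants of `v`: the vertices other than `v` which no directed path from `v`
reaches. -/
def nonDescendants (D : Digraph V) (v : V) : Set V :=
  {u | u ≠ v ∧ ¬ Relation.TransGen D.Adj v u}

/-- The intervention graph `D^(I)`: all edges directed towards vertices of `I` are removed. -/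
def interventionGraph (D : Digraph V) (I : Set V) : Digraph V where
  Adj a b := D.Adj a b ∧ b ∉ I

/-- What is left of a partially directed graph after all its directed edges are removed. -/
def undirectedPart (R : Digraph V) : SimpleGraph V where
  Adj a b := a ≠ b ∧ R.Adj a b ∧ R.Adj b a
  symm := ⟨fun _ _ h => ⟨h.1.symm, h.2.2, h.2.1⟩⟩
  loopless := ⟨fun _ h => h.1 rfl⟩

/-- The (vertex sets of the) chain components of `R`: the connected components of `R` after all
directed edges are removed. -/
abbrev ChainComponent (R : Digraph V) : Type u :=
  (undirectedPart R).ConnectedComponent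

/-- A chain component as an undirected graph of its own, on its own vertex set. -/
def ChainComponent.graph {R : Digraph V} (C : ChainComponent R) : SimpleGraph C.supp :=
  (undirectedPart R).induce C.supp

end Graphs

/-! ### Distributions of finitely many random variables with finitely many values -/

section Distributions

variable {V : Type u} {X : V → Type}

/-- `p` is a joint probability mass function of variables `v : V` with values in `X v`. -/
def IsDistribution (p : (∀ v, X v) → ℝ) : Prop :=
  (∀ x, 0 ≤ p x) ∧ ∑ᶠ x, p x = 1

/-- The probability that every variable in `S` takes the value that `x` gives it. -/
noncomputable def marginal (p : (∀ v, X v) → ℝ) (S : Set V) (x : ∀ v, X v) : ℝ :=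
  ∑ᶠ y ∈ {y : ∀ v, X v | ∀ v ∈ S, y v = x v}, p y

/-- Under `p` the variables in `A` are independent of those in `B` given those in `C`. The usual
equation `P(A, B | C) = P(A | C) * P(B | C)` is multiplied by `P(C) ^ 2`, so that values of the
variables in `C` of probability zero impose no condition. -/
def CondIndep (p : (∀ v, X v) → ℝ) (A B C : Set V) : Prop :=
  ∀ x, marginal p (A ∪ B ∪ C) x * marginal p C x = marginal p (A ∪ C) x * marginal p (B ∪ C) x

/-- Under `p` and `q` the variable `v` has the same conditional distribution given the variables
in `S`, at all values of the latter that have positive probability under both. -/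
def SameConditional (p q : (∀ v, X v) → ℝ) (v : V) (S : Set V) : Prop :=
  ∀ x, marginal p ({v} ∪ S) x * marginal q S x = marginal q ({v} ∪ S) x * marginal p S x

/-- The Markov property: every variable is independent of its non-descendants given its
parents. -/
def IsMarkov (D : Digraph V) (p : (∀ v, X v) → ℝ) : Prop :=
  ∀ v, CondIndep p {v} (nonDescendants D v) (parents D v)

/-- `P I`, for `I ∈ 𝓘 ∪ {∅}`, are an observational distribution (`I = ∅`) and interventional
distributions that the causal DAG `D` can generate together: under the intervention on `I` the
distribution has the Markov property for the intervention graph `D^(I)`, and the conditional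
distribution of a variable given its parents in `D` is the same under all interventions that do
not target it. -/
def IsInterventionalFamily (𝓘 : Set (Set V)) (D : Digraph V)
    (P : Set V → (∀ v, X v) → ℝ) : Prop :=
  (∀ I ∈ 𝓘 ∪ {∅}, IsDistribution (P I) ∧ IsMarkov (interventionGraph D I) (P I)) ∧
  ∀ I ∈ 𝓘 ∪ {∅}, ∀ J ∈ 𝓘 ∪ {∅}, ∀ v, v ∉ I → v ∉ J → SameConditional (P I) (P J) v (parents D v)

end Distributions

/-! ### Markov equivalence and essential graphs -/

section Equivalence

variable {V : Type u} [Finite V]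

/-- Two graphs are Markov equivalent if the same joint distributions have the Markov property
with respect to them. -/
def MarkovEquiv (D₁ D₂ : Digraph V) : Prop :=
  ∀ (X : V → Type) [∀ v, Finite (X v)] (p : (∀ v, X v) → ℝ), IsDistribution p →
    (IsMarkov D₁ p ↔ IsMarkov D₂ p)

/-- Two graphs are `𝓘`-Markov equivalent if they are statistically indistinguishable under the
interventions in `𝓘` (observational data being always available): they can generate the same
families of observational and interventional distributions. -/
def IMarkovEquiv (𝓘 : Set (Set V)) (D₁ D₂ : Digraph V) : Prop :=
  ∀ (X : V → Type) [∀ v, Finite (X v)] (P : Set V → (∀ v, X v) → ℝ),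
    IsInterventionalFamily 𝓘 D₁ P ↔ IsInterventionalFamily 𝓘 D₂ P

/-- The essential graph of `D`: the union of all DAGs that are Markov equivalent to `D`. -/
def essentialGraph (D : Digraph V) : Digraph V :=
  sSup {D' | IsDAG D' ∧ MarkovEquiv D D'}

/-- The `𝓘`-essential graph of `D`: the union of all DAGs that are `𝓘`-Markov equivalent
to `D`. -/
def iEssentialGraph (𝓘 : Set (Set V)) (D : Digraph V) : Digraph V :=
  sSup {D' | IsDAG D' ∧ IMarkovEquiv 𝓘 D D'}

/-- The Markov equivalence class that the undirected graph `G` represents: all DAGs whose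
essential graph is `G`. -/
def MEC (G : SimpleGraph V) : Set (Digraph V) :=
  {D | IsDAG D ∧ essentialGraph D = ofUndirected G}

/-- The intervention result space of `G`: the `𝓘`-essential graphs of the DAGs in the Markov
equivalence class of `G`. -/
def interventionResults (𝓘 : Set (Set V)) (G : SimpleGraph V) : Set (Digraph V) :=
  iEssentialGraph 𝓘 '' MEC G

end Equivalence

end Causal

namespace Causal

universe u

/-! ### Marginals of a joint distribution -/

section Marginals

variable {V : Type u} {X : V → Type}

/-! An undirected graph represents exactly its acyclic moral orientations (`MEC_eq_orientations`).
Grouping those of `G` by `𝓘`-essential graph reduces the formula to counting one fibre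
(`ncard_iEssentialGraph_fiber`), and the fibre of `D` is its `𝓘`-Markov equivalence class.

On these orientations the equivalence is combinatorial: `D` and `D'` are equivalent iff they agree
on the edges cut by some target set, i.e. with exactly one end in it. Agreement suffices because `D`
can be turned into `D'` by reversing uncut covered edges, which preserves the generated families
(`iMarkovEquiv_of_sameSkeleton`). It is necessary because uniform distributions subject to one
parity equation detect the directions of cut edges (`IMarkovEquiv.adj_of_cut`); they also detect
adjacencies and colliders, so that no equivalent DAG lies outside the orientations of `G`.

Closing the cut edges under two propagation rules gives the `Forced` edges, common to the whole
class. The crux is `Forced.extend`: forced edges enter all vertices of a chain component alike.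
Hence any acyclic moral orientation of the remaining edges can be glued to the forced ones
(`glue_mem_orientations`). Perfect elimination orders show that each remaining edge takes both
directions (`exists_orientation_adj`), so these edges form the undirected part of the essential
graph. Its components are oriented independently, whence the product (`orientationsEquiv`). -/

open Classical in
theorem marginal_eq_sum [Fintype (∀ v, X v)] (p : (∀ v, X v) → ℝ) (S : Set V) (x : ∀ v, X v) :
    marginal p S x = ∑ y, if ∀ v ∈ S, y v = x v then p y else 0 := by
  rw [marginal, finsum_mem_def, finsum_eq_sum_of_fintype]
  refine Finset.sum_congr rfl fun y _ => ?_
  simp [Set.indicator]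

theorem marginal_congr (p : (∀ v, X v) → ℝ) {S : Set V} {x y : ∀ v, X v}
    (h : ∀ v ∈ S, x v = y v) : marginal p S x = marginal p S y := by
  have : {z : ∀ v, X v | ∀ v ∈ S, z v = x v} = {z | ∀ v ∈ S, z v = y v} := by
    ext z
    exact forall₂_congr fun v hv => by rw [h v hv]
  rw [marginal, marginal, this]

variable [Finite V] [∀ v, Finite (X v)]

omit [Finite V] [∀ v, Finite (X v)] in
theorem marginal_nonneg {p : (∀ v, X v) → ℝ} (hp : ∀ x, 0 ≤ p x) (S : Set V) (x : ∀ v, X v) :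
    0 ≤ marginal p S x :=
  finsum_nonneg fun y => finsum_nonneg fun _ => hp y

theorem marginal_anti {p : (∀ v, X v) → ℝ} (hp : ∀ x, 0 ≤ p x) {S T : Set V} (h : S ⊆ T)
    (x : ∀ v, X v) : marginal p T x ≤ marginal p S x := by
  classical
  have := Fintype.ofFinite (∀ v, X v)
  rw [marginal_eq_sum, marginal_eq_sum]
  refine Finset.sum_le_sum fun y _ => ?_
  by_cases h1 : ∀ v ∈ T, y v = x v
  · rw [if_pos h1, if_pos fun v hv => h1 v (h hv)]
  · rw [if_neg h1]
    split_ifs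
    · exact hp y
    · exact le_rfl

theorem marginal_eq_zero {p : (∀ v, X v) → ℝ} (hp : ∀ x, 0 ≤ p x) {S T : Set V} (h : S ⊆ T)
    {x : ∀ v, X v} (h0 : marginal p S x = 0) : marginal p T x = 0 :=
  le_antisymm (h0 ▸ marginal_anti hp h x) (marginal_nonneg hp T x)

omit [Finite V] [∀ v, Finite (X v)] in
theorem marginal_empty {p : (∀ v, X v) → ℝ} (hp : IsDistribution p) (x : ∀ v, X v) :
    marginal p ∅ x = 1 := by
  simpa [marginal] using hp.2

open Classical in
theorem marginal_sum_out (p : (∀ v, X v) → ℝ) {S : Set V} {w : V} [Fintype (X w)] (hw : w ∉ S)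
    (x : ∀ v, X v) :
    marginal p S x = ∑ t : X w, marginal p (insert w S) (Function.update x w t) := by
  have := Fintype.ofFinite (∀ v, X v)
  simp only [marginal_eq_sum]
  rw [Finset.sum_comm]
  refine Finset.sum_congr rfl fun y _ => ?_
  rw [Finset.sum_eq_single (y w)]
  · congr 1
    refine propext ⟨fun h v hv => ?_, fun h v hv => ?_⟩
    · rcases Set.mem_insert_iff.1 hv with rfl | hv
      · simp
      · have : v ≠ w := fun e => hw (e ▸ hv)
        simp [this, h v hv]
    · have : v ≠ w := fun e => hw (e ▸ hv)
      simpa [this] using h v (Set.mem_insert_of_mem _ hv)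
  · intro t _ ht
    rw [if_neg]
    intro h
    exact ht (by simpa using (h w (Set.mem_insert _ _)).symm)
  · simp

/-- An equation between products of marginals survives summing out a variable that occurs in one
factor on each side. -/
theorem sum_out_eq {p q : (∀ v, X v) → ℝ} {S₁ S₂ T₁ T₂ : Set V} {w : V}
    (h₁ : w ∉ S₁) (h₂ : w ∉ S₂) (h₃ : w ∉ T₁) (h₄ : w ∉ T₂)
    (h : ∀ x, marginal p (insert w S₁) x * marginal q T₁ x
      = marginal q (insert w S₂) x * marginal p T₂ x) (x : ∀ v, X v) :
    marginal p S₁ x * marginal q T₁ x = marginal q S₂ x * marginal p T₂ x := by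
  classical
  have := Fintype.ofFinite (X w)
  rw [marginal_sum_out p h₁, marginal_sum_out q h₂, Finset.sum_mul, Finset.sum_mul]
  refine Finset.sum_congr rfl fun t _ => ?_
  have e : ∀ (r : (∀ v, X v) → ℝ) {T : Set V}, w ∉ T →
      marginal r T x = marginal r T (Function.update x w t) := by
    intro r T hT
    refine marginal_congr r fun v hv => ?_
    have : v ≠ w := fun e => hT (e ▸ hv)
    simp [this]
  rw [e q h₃, e p h₄]
  exact h _

/-- Conditional independence of `v` from a set passes to subsets. -/
theorem indep_subset {p : (∀ v, X v) → ℝ} {v : V} {N C : Set V} (hvN : v ∉ N) (hCN : C ⊆ N)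
    (h : ∀ x, marginal p (insert v N) x * marginal p C x
      = marginal p N x * marginal p (insert v C) x)
    {B : Set V} (hCB : C ⊆ B) (hBN : B ⊆ N) (x : ∀ v, X v) :
    marginal p (insert v B) x * marginal p C x
      = marginal p B x * marginal p (insert v C) x := by
  -- The elements of `N \ B` are summed out one at a time.
  obtain ⟨E, hE, rfl⟩ : ∃ E : Set V, Disjoint E B ∧ B ∪ E = N :=
    ⟨N \ B, Set.disjoint_sdiff_left, Set.union_sdiff_cancel hBN⟩
  clear hBN hCN
  induction E, E.toFinite using Set.Finite.induction_on with
  | empty => simpa using h x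
  | @insert w E hw _ ih =>
    rw [Set.disjoint_insert_left] at hE
    have hwBE : w ∉ B ∪ E := fun h => h.elim hE.1 hw
    rw [Set.union_insert] at hvN h
    have hwv : w ≠ v := fun e => hvN (e ▸ Set.mem_insert _ _)
    refine ih hE.2 (fun h => hvN (Set.mem_insert_of_mem _ h)) fun x => ?_
    refine sum_out_eq (w := w) ?_ hwBE (fun h => hE.1 (hCB h)) ?_ ?_ x
    · exact fun h => (Set.mem_insert_iff.1 h).elim hwv hwBE
    · exact fun h => (Set.mem_insert_iff.1 h).elim hwv (fun h => hE.1 (hCB h))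
    · intro x
      rw [Set.insert_comm]
      exact h x

end Marginals

/-! ### The Markov property and factorization over ancestral sets -/

section Factorization

variable {V : Type u} {X : V → Type}

theorem IsDAG.irrefl {D : Digraph V} (h : IsDAG D) (a : V) : ¬ D.Adj a a :=
  fun e => h a (.single e)

theorem IsDAG.asymm {D : Digraph V} (h : IsDAG D) {a b : V} (e : D.Adj a b) : ¬ D.Adj b a :=
  fun e' => h a (.tail (.single e) e')

theorem IsDAG.mono {D D' : Digraph V} (h : IsDAG D) (hle : ∀ a b, D'.Adj a b → D.Adj a b) :
    IsDAG D' :=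
  fun v hv => h v (Relation.TransGen.mono hle _ _ hv)

theorem IsDAG.intervention {D : Digraph V} (h : IsDAG D) (I : Set V) :
    IsDAG (interventionGraph D I) :=
  h.mono fun _ _ e => e.1

theorem IsDAG.exists_sink [Finite V] {D : Digraph V} (h : IsDAG D) {A : Set V}
    (hA : A.Nonempty) : ∃ v ∈ A, ∀ w ∈ A, ¬ D.Adj v w := by
  let r : V → V → Prop := fun a b => Relation.TransGen D.Adj b a
  have : IsTrans V r := ⟨fun a b c hab hbc => hbc.trans hab⟩
  have : Std.Irrefl r := ⟨h⟩
  obtain ⟨v, hv, hmin⟩ := (Finite.wellFounded_of_trans_of_irrefl r).has_min A hA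
  exact ⟨v, hv, fun w hw e => hmin w hw (.single e)⟩

theorem IsDAG.exists_source [Finite V] {D : Digraph V} (h : IsDAG D) {A : Set V}
    (hA : A.Nonempty) : ∃ v ∈ A, ∀ w ∈ A, ¬ Relation.TransGen D.Adj w v := by
  have : IsTrans V (Relation.TransGen D.Adj) := ⟨fun a b c hab hbc => hab.trans hbc⟩
  have : Std.Irrefl (Relation.TransGen D.Adj) := ⟨h⟩
  obtain ⟨v, hv, hmin⟩ :=
    (Finite.wellFounded_of_trans_of_irrefl (Relation.TransGen D.Adj)).has_min A hA
  exact ⟨v, hv, hmin⟩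

theorem IsDAG.exists_last [Finite V] {D : Digraph V} (h : IsDAG D) {A : Set V}
    (hA : A.Nonempty) : ∃ v ∈ A, ∀ w ∈ A, ¬ Relation.TransGen D.Adj v w := by
  let r : V → V → Prop := fun a b => Relation.TransGen D.Adj b a
  have : IsTrans V r := ⟨fun a b c hab hbc => hbc.trans hab⟩
  have : Std.Irrefl r := ⟨h⟩
  obtain ⟨v, hv, hmin⟩ := (Finite.wellFounded_of_trans_of_irrefl r).has_min A hA
  exact ⟨v, hv, hmin⟩

theorem IsDAG.parents_subset {D : Digraph V} (h : IsDAG D) (v : V) :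
    parents D v ⊆ nonDescendants D v := by
  intro u (hu : D.Adj u v)
  exact ⟨fun e => h.irrefl v (e ▸ hu), fun t => h v (t.tail hu)⟩

/-- A set is ancestral if it contains the parents of its elements. -/
def IsAncestral (D : Digraph V) (A : Set V) : Prop :=
  ∀ a ∈ A, parents D a ⊆ A

theorem isAncestral_nonDescendants {D : Digraph V} (v : V) :
    IsAncestral D (nonDescendants D v) := by
  rintro a ⟨_, ha⟩ u (hu : D.Adj u a)
  exact ⟨fun e => ha (e ▸ .single hu), fun t => ha (t.tail hu)⟩

theorem IsDAG.isAncestral_insert {D : Digraph V} (h : IsDAG D) (v : V) :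
    IsAncestral D (insert v (nonDescendants D v)) := by
  intro a ha
  rcases Set.mem_insert_iff.1 ha with rfl | ha
  · exact (h.parents_subset a).trans (Set.subset_insert _ _)
  · exact (isAncestral_nonDescendants v a ha).trans (Set.subset_insert _ _)

/-- The conditional probability of the value of `v` given its parents. -/
noncomputable def kernel (D : Digraph V) (p : (∀ v, X v) → ℝ) (v : V) (x : ∀ v, X v) : ℝ :=
  marginal p (insert v (parents D v)) x / marginal p (parents D v) x

/-- The marginals of `p` on ancestral sets are the products of the conditional probabilities. -/
def Factorizes (D : Digraph V) (p : (∀ v, X v) → ℝ) : Prop :=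
  ∀ A : Finset V, IsAncestral D (A : Set V) → ∀ x, marginal p (A : Set V) x = ∏ v ∈ A, kernel D p v x

variable [Finite V] [∀ v, Finite (X v)]

omit [Finite V] [∀ v, Finite (X v)] in
theorem isMarkov_iff {D : Digraph V} (hD : IsDAG D) (p : (∀ v, X v) → ℝ) :
    IsMarkov D p ↔ ∀ v x,
      marginal p (insert v (nonDescendants D v)) x * marginal p (parents D v) x
      = marginal p (nonDescendants D v) x * marginal p (insert v (parents D v)) x := by
  refine forall_congr' fun v => forall_congr' fun x => ?_
  rw [Set.union_assoc, Set.singleton_union, Set.singleton_union,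
    Set.union_eq_left.2 (hD.parents_subset v), mul_comm (marginal p (nonDescendants D v) x)]

/-- Remove a sink `v` of `A`. The rest of `A` lies between the parents and the non-descendants of
`v`, so conditioning `v` on it gives the kernel of `v`. -/
theorem IsMarkov.factorizes {D : Digraph V} (hD : IsDAG D) {p : (∀ v, X v) → ℝ}
    (hp : IsDistribution p) (h : IsMarkov D p) : Factorizes D p := by
  classical
  rw [isMarkov_iff hD] at h
  intro A
  induction hn : A.card generalizing A with
  | zero =>
    intro _ x
    rw [Finset.card_eq_zero.1 hn]
    simpa using marginal_empty hp x
  | succ n ih =>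
    intro hA x
    obtain ⟨v, hv, hsink⟩ := hD.exists_sink (A := (A : Set V))
      (Finset.coe_nonempty.2 (Finset.card_pos.1 (by omega)))
    have hvA : v ∈ A := hv
    have hAe : IsAncestral D ((A.erase v : Finset V) : Set V) := by
      intro a ha u hu
      have ha' := Finset.mem_erase.1 (Finset.mem_coe.1 ha)
      exact Finset.mem_coe.2 (Finset.mem_erase.2
        ⟨fun e => hsink a ha'.2 (e ▸ hu), hA a ha'.2 hu⟩)
    have hnd : ((A.erase v : Finset V) : Set V) ⊆ nonDescendants D v := by
      intro w hw
      have hw' := Finset.mem_erase.1 (Finset.mem_coe.1 hw)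
      refine ⟨hw'.1, fun t => ?_⟩
      obtain ⟨c, hvc, hcw⟩ := Relation.TransGen.head'_iff.1 t
      refine hsink c ?_ hvc
      clear t hw hvc
      induction hcw using Relation.ReflTransGen.head_induction_on with
      | refl => exact hw'.2
      | head e _ ih => exact hA _ ih e
    have hpa : parents D v ⊆ ((A.erase v : Finset V) : Set V) := by
      intro u hu
      exact Finset.mem_coe.2 (Finset.mem_erase.2
        ⟨fun e => hD.irrefl v (e ▸ hu), hA v hv hu⟩)
    have key := indep_subset (fun hmem => hmem.1 rfl) (hD.parents_subset v) (h v) hpa hnd x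
    have hins : insert v ((A.erase v : Finset V) : Set V) = (A : Set V) := by
      rw [← Finset.coe_insert, Finset.insert_erase hvA]
    rw [hins] at key
    rw [← Finset.prod_erase_mul A _ hvA, ← ih (A.erase v)
      (by rw [Finset.card_erase_of_mem hvA]; omega) hAe x, kernel]
    -- Division by zero makes the kernel `0` here, which is right because the marginal on `A`
    -- vanishes too.
    by_cases h0 : marginal p (parents D v) x = 0
    · rw [h0, div_zero, mul_zero]
      exact marginal_eq_zero hp.1 (hA v hv) h0
    · field_simp
      exact key

/-- The non-descendants of `v` form an ancestral set with or without `v`; the two factorizations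
differ by the kernel of `v`. -/
theorem Factorizes.isMarkov {D : Digraph V} (hD : IsDAG D) {p : (∀ v, X v) → ℝ}
    (hp : IsDistribution p) (h : Factorizes D p) : IsMarkov D p := by
  classical
  rw [isMarkov_iff hD]
  intro v x
  obtain ⟨A, hA⟩ := (nonDescendants D v).toFinite.exists_finset_coe
  have hvA : v ∉ A := fun hv => by
    have : v ∈ nonDescendants D v := hA ▸ Finset.mem_coe.2 hv
    exact this.1 rfl
  have h1 := h A (hA ▸ isAncestral_nonDescendants v) x
  have h2 := h (insert v A) (by rw [Finset.coe_insert, hA]; exact hD.isAncestral_insert v) x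
  rw [Finset.prod_insert hvA, ← h1, Finset.coe_insert, hA, kernel] at h2
  rw [h2]
  by_cases h0 : marginal p (parents D v) x = 0
  · rw [marginal_eq_zero hp.1 (Set.subset_insert v _) h0, h0]
    simp
  · field_simp

end Factorization

/-! ### Reversal of covered edges -/

section Reversal

variable {V : Type u} {X : V → Type}

/-- The edge `a → b` is covered: the parents of `b` are `a` and the parents of `a`. -/
def IsCovered (D : Digraph V) (a b : V) : Prop :=
  parents D b = insert a (parents D a)

/-- The graph `D` with the edge `a → b` reversed. -/
def reverseEdge (D : Digraph V) (a b : V) : Digraph V where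
  Adj u v := (D.Adj u v ∧ ¬ (u = a ∧ v = b)) ∨ (u = b ∧ v = a)

variable {D : Digraph V} {a b : V}

theorem IsCovered.adj (h : IsCovered D a b) : D.Adj a b := by
  have : a ∈ parents D b := by rw [h]; exact Set.mem_insert _ _
  exact this

theorem IsCovered.ne (h : IsCovered D a b) (hD : IsDAG D) : a ≠ b :=
  fun e => hD.irrefl a (by simpa [e] using h.adj)

theorem IsCovered.parents_left (h : IsCovered D a b) (hD : IsDAG D) :
    parents (reverseEdge D a b) a = insert b (parents D a) := by
  ext u
  have := h.ne hD
  simp only [parents, reverseEdge, Set.mem_ofPred_eq, Set.mem_insert_iff]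
  tauto

theorem IsCovered.parents_right (h : IsCovered D a b) (hD : IsDAG D) :
    parents (reverseEdge D a b) b = parents D a := by
  ext u
  have hne := h.ne hD
  have h1 : D.Adj u b ↔ u = a ∨ D.Adj u a := by
    have := congrArg (u ∈ ·) h
    simpa [parents] using this
  have h2 : u = a → ¬ D.Adj u a := fun e => e ▸ hD.irrefl a
  simp only [parents, reverseEdge, Set.mem_ofPred_eq, h1]
  tauto

theorem parents_reverseEdge_of_ne {v : V} (ha : v ≠ a) (hb : v ≠ b) :
    parents (reverseEdge D a b) v = parents D v := by
  ext u
  simp [parents, reverseEdge, ha, hb]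

theorem IsCovered.reverse (h : IsCovered D a b) (hD : IsDAG D) :
    IsCovered (reverseEdge D a b) b a := by
  rw [IsCovered, h.parents_left hD, h.parents_right hD]

theorem IsCovered.reverseEdge_reverseEdge (h : IsCovered D a b) (hD : IsDAG D) :
    reverseEdge (reverseEdge D a b) b a = D := by
  have hne := h.ne hD
  have h1 := h.adj
  have h2 := hD.asymm h1
  ext u v
  simp only [reverseEdge]
  constructor
  · rintro (⟨⟨h, _⟩ | h, h'⟩ | ⟨rfl, rfl⟩)
    · exact h
    · exact absurd h h'
    · exact h1
  · intro e
    by_cases hu : u = a ∧ v = b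
    · exact Or.inr hu
    · refine Or.inl ⟨Or.inl ⟨e, hu⟩, ?_⟩
      rintro ⟨rfl, rfl⟩
      exact h2 e

/-- After the reversal every parent of `b` is a parent of `a` in `D`, so a passage through `b → a`
can be shortcut in `D`. Paths that start at `b` have nothing to shortcut and are tracked separately
in `key`. -/
theorem IsCovered.isDAG_reverseEdge (h : IsCovered D a b) (hD : IsDAG D) :
    IsDAG (reverseEdge D a b) := by
  have hne := h.ne hD
  have hpb : ∀ {v}, (reverseEdge D a b).Adj v b → D.Adj v a := by
    intro v hv
    have : v ∈ parents (reverseEdge D a b) b := hv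
    rw [h.parents_right hD] at this
    exact this
  have key : ∀ u v, Relation.TransGen (reverseEdge D a b).Adj u v →
      (u ≠ b ∧ Relation.TransGen D.Adj u v ∧ (u = a → v ≠ b)) ∨
      (u = b ∧ v ≠ b ∧ (v = a ∨ Relation.TransGen D.Adj a v)) := by
    intro u v huv
    induction huv with
    | @single v e =>
      rcases e with ⟨e, hn⟩ | ⟨rfl, rfl⟩
      · by_cases hu : u = b
        · subst hu
          exact Or.inr ⟨rfl, fun e' => hD.irrefl u (e' ▸ e), Or.inr (.tail (.single h.adj) e)⟩
        · exact Or.inl ⟨hu, .single e, fun e1 e2 => hn ⟨e1, e2⟩⟩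
      · exact Or.inr ⟨rfl, hne, Or.inl rfl⟩
    | @tail v w _ e ih =>
      rcases ih with ⟨hu, huv, hab⟩ | ⟨rfl, hv, hav⟩
      · refine Or.inl ⟨hu, ?_, ?_⟩
        · rcases e with ⟨e, _⟩ | ⟨rfl, rfl⟩
          · exact huv.tail e
          · obtain ⟨z, huz, hzb⟩ := Relation.TransGen.tail'_iff.1 huv
            have hz : z ∈ parents D v := hzb
            rw [h] at hz
            rcases Set.mem_insert_iff.1 hz with rfl | hz
            · rcases Relation.reflTransGen_iff_eq_or_transGen.1 huz with rfl | t
              · exact absurd rfl (hab rfl)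
              · exact t
            · exact Relation.TransGen.tail' huz hz
        · rintro rfl rfl
          exact hD u (huv.tail (hpb e))
      · refine Or.inr ⟨rfl, ?_, ?_⟩
        · rintro rfl
          have := hpb e
          rcases hav with rfl | hav
          · exact hD.irrefl _ this
          · exact hD _ (hav.tail this)
        · rcases e with ⟨e, _⟩ | ⟨e, _⟩
          · rcases hav with rfl | hav
            · exact Or.inr (.single e)
            · exact Or.inr (hav.tail e)
          · exact absurd e hv
  intro v hv
  rcases key v v hv with ⟨_, t, _⟩ | ⟨e, hn, _⟩
  · exact hD v t
  · exact hn e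

theorem IsCovered.intervention (h : IsCovered D a b) {I : Set V} (ha : a ∉ I) (hb : b ∉ I) :
    IsCovered (interventionGraph D I) a b := by
  have h' : ∀ v ∉ I, parents (interventionGraph D I) v = parents D v := by
    intro v hv
    ext u
    simp [parents, interventionGraph, hv]
  rw [IsCovered, h' a ha, h' b hb, h]

theorem intervention_reverseEdge {I : Set V} (ha : a ∉ I) :
    interventionGraph (reverseEdge D a b) I = reverseEdge (interventionGraph D I) a b := by
  ext u v
  simp only [interventionGraph, reverseEdge]
  constructor
  · tauto
  · rintro (h | ⟨rfl, rfl⟩)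
    · tauto
    · exact ⟨Or.inr ⟨rfl, rfl⟩, ha⟩

theorem intervention_reverseEdge_of_mem {I : Set V} (ha : a ∈ I) (hb : b ∈ I) :
    interventionGraph (reverseEdge D a b) I = interventionGraph D I := by
  ext u v
  simp only [interventionGraph, reverseEdge]
  constructor
  · rintro ⟨h | ⟨rfl, rfl⟩, h'⟩
    · exact ⟨h.1, h'⟩
    · exact absurd ha h'
  · rintro ⟨h, h'⟩
    exact ⟨Or.inl ⟨h, fun e => h' (e.2 ▸ hb)⟩, h'⟩

variable [Finite V] [∀ v, Finite (X v)]

omit [Finite V] [∀ v, Finite (X v)] in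
theorem kernel_congr {D D' : Digraph V} {v : V} (h : parents D v = parents D' v)
    (p : (∀ v, X v) → ℝ) (x : ∀ v, X v) : kernel D p v x = kernel D' p v x := by
  rw [kernel, kernel, h]

/-- Both products are the conditional probability of the pair `a`, `b` given the parents of `a`. -/
theorem IsCovered.kernel_mul_kernel (h : IsCovered D a b) (hD : IsDAG D) {p : (∀ v, X v) → ℝ}
    (hp : ∀ x, 0 ≤ p x) (x : ∀ v, X v) :
    kernel (reverseEdge D a b) p a x * kernel (reverseEdge D a b) p b x
      = kernel D p a x * kernel D p b x := by
  have aux : ∀ {C E F : Set V}, C ⊆ E → E ⊆ F →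
      marginal p F x / marginal p E x * (marginal p E x / marginal p C x)
        = marginal p F x / marginal p C x := by
    intro C E F h1 h2
    by_cases h0 : marginal p E x = 0
    · rw [h0, marginal_eq_zero hp h2 h0]
      simp
    · field_simp
  rw [kernel, kernel, kernel, kernel, h.parents_left hD, h.parents_right hD, h,
    aux (Set.subset_insert _ _) (Set.subset_insert _ _), mul_comm,
    aux (Set.subset_insert _ _) (Set.subset_insert _ _), Set.insert_comm]

/-- An ancestral set of the new graph containing `a` also contains `b` and is ancestral in `D`, so
only the two kernels are exchanged. If it contains `b` alone, `a` is added and summed out again. If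
it contains neither, nothing changes. -/
theorem IsCovered.factorizes_reverseEdge (h : IsCovered D a b) (hD : IsDAG D)
    {p : (∀ v, X v) → ℝ} (hp : IsDistribution p) (hF : Factorizes D p) :
    Factorizes (reverseEdge D a b) p := by
  classical
  have hne := h.ne hD
  have main : ∀ A : Finset V, a ∈ A → IsAncestral (reverseEdge D a b) (A : Set V) → ∀ x,
      marginal p (A : Set V) x = ∏ v ∈ A, kernel (reverseEdge D a b) p v x := by
    intro A haA hA x
    have hpa := hA a haA
    rw [h.parents_left hD] at hpa
    have hbA : b ∈ A := hpa (Set.mem_insert _ _)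
    have hA' : IsAncestral D (A : Set V) := by
      intro v hv
      by_cases hva : v = a
      · subst hva
        exact (Set.subset_insert _ _).trans hpa
      by_cases hvb : v = b
      · subst hvb
        rw [h]
        exact Set.insert_subset haA ((Set.subset_insert _ _).trans hpa)
      rw [← parents_reverseEdge_of_ne hva hvb]
      exact hA v hv
    have hbA' : b ∈ A.erase a := Finset.mem_erase.2 ⟨hne.symm, hbA⟩
    rw [hF A hA' x, ← Finset.mul_prod_erase A _ haA, ← Finset.mul_prod_erase (A.erase a) _ hbA',
      ← Finset.mul_prod_erase A (fun v => kernel (reverseEdge D a b) p v x) haA,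
      ← Finset.mul_prod_erase (A.erase a) (fun v => kernel (reverseEdge D a b) p v x) hbA',
      ← mul_assoc, ← mul_assoc, h.kernel_mul_kernel hD hp.1]
    congr 1
    refine Finset.prod_congr rfl fun v hv => ?_
    simp only [Finset.mem_erase] at hv
    exact kernel_congr (parents_reverseEdge_of_ne hv.2.1 hv.1).symm p x
  intro A hA x
  by_cases haA : a ∈ A
  · exact main A haA hA x
  by_cases hbA : b ∈ A
  · have hpb := hA b hbA
    rw [h.parents_right hD] at hpb
    have hA' : IsAncestral (reverseEdge D a b) ((insert a A : Finset V) : Set V) := by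
      intro v hv
      rw [Finset.coe_insert] at hv ⊢
      rcases Set.mem_insert_iff.1 hv with rfl | hv
      · rw [h.parents_left hD]
        exact (Set.insert_subset hbA hpb).trans (Set.subset_insert _ _)
      · exact (hA v hv).trans (Set.subset_insert _ _)
    have hm := main _ (Finset.mem_insert_self a A) hA'
    have := Fintype.ofFinite (X a)
    have hup : ∀ {S : Set V} (t : X a), a ∉ S →
        marginal p S (Function.update x a t) = marginal p S x := by
      intro S t hS
      refine marginal_congr p fun v hv => ?_
      have : v ≠ a := fun e => hS (e ▸ hv)
      simp [this]
    have haS : a ∉ (A : Set V) := haA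
    have hk : ∀ t : X a, ∏ v ∈ A, kernel (reverseEdge D a b) p v (Function.update x a t)
        = ∏ v ∈ A, kernel (reverseEdge D a b) p v x := by
      intro t
      refine Finset.prod_congr rfl fun v hv => ?_
      have hpv : a ∉ parents (reverseEdge D a b) v := fun hmem => haS (hA v hv hmem)
      rw [kernel, kernel, hup t hpv, hup t]
      exact fun hmem => (Set.mem_insert_iff.1 hmem).elim (fun e => haA (e ▸ hv)) hpv
    have haC : a ∉ insert b (parents D a) := fun hmem =>
      (Set.mem_insert_iff.1 hmem).elim hne (hD.irrefl a)
    rw [marginal_sum_out p haS]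
    simp_rw [← Finset.coe_insert, hm, Finset.prod_insert haA, hk]
    rw [← Finset.sum_mul]
    have hs : ∑ t : X a, kernel (reverseEdge D a b) p a (Function.update x a t)
        = marginal p (insert b (parents D a)) x / marginal p (insert b (parents D a)) x := by
      simp_rw [kernel, h.parents_left hD, hup _ haC]
      rw [← Finset.sum_div, ← marginal_sum_out p haC]
    rw [hs]
    -- The kernels of `a` sum to `1` only at values of positive probability; otherwise the kernel of
    -- `b` makes the product vanish.
    by_cases h0 : marginal p (insert b (parents D a)) x = 0
    · rw [h0, div_zero, zero_mul]
      symm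
      refine Finset.prod_eq_zero hbA ?_
      rw [kernel, h.parents_right hD, h0, zero_div]
    · rw [div_self h0, one_mul]
  · have hpar : ∀ v ∈ A, parents (reverseEdge D a b) v = parents D v := fun v hv =>
      parents_reverseEdge_of_ne (fun e => haA (e ▸ hv)) (fun e => hbA (e ▸ hv))
    rw [hF A (fun v hv => hpar v hv ▸ hA v hv) x]
    exact Finset.prod_congr rfl fun v hv => kernel_congr (hpar v hv).symm p x

theorem IsCovered.isMarkov_reverseEdge (h : IsCovered D a b) (hD : IsDAG D)
    {p : (∀ v, X v) → ℝ} (hp : IsDistribution p) (hM : IsMarkov D p) :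
    IsMarkov (reverseEdge D a b) p :=
  (h.factorizes_reverseEdge hD hp (hM.factorizes hD hp)).isMarkov (h.isDAG_reverseEdge hD) hp

/-- The chain rule `P(a, b | C) = P(a | C) P(b | a, C)` in cross-multiplied form. Cancelling needs
positive probabilities, hence the separate zero cases. -/
theorem SameConditional.chain {p q : (∀ v, X v) → ℝ} (hp : ∀ x, 0 ≤ p x)
    (hq : ∀ x, 0 ≤ q x) {C : Set V}
    (h1 : SameConditional p q a C) (h2 : SameConditional p q b (insert a C)) (x : ∀ v, X v) :
    marginal p (insert b (insert a C)) x * marginal q C x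
      = marginal q (insert b (insert a C)) x * marginal p C x := by
  have e1 := h1 x
  have e2 := h2 x
  simp only [Set.singleton_union] at e1 e2
  by_cases h0 : marginal p (insert a C) x = 0
  · rw [marginal_eq_zero hp (Set.subset_insert b _) h0] at e2 ⊢
    rw [h0] at e1
    by_cases h3 : marginal q (insert a C) x = 0
    · rw [marginal_eq_zero hq (Set.subset_insert b _) h3]
      ring
    · have : marginal p C x = 0 := by
        rcases mul_eq_zero.1 ((zero_mul _).symm.trans e1).symm with h | h
        · exact absurd h h3
        · exact h
      rw [this]
      ring
  by_cases h3 : marginal q (insert a C) x = 0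
  · rw [marginal_eq_zero hq (Set.subset_insert b _) h3]
    have : marginal q C x = 0 := by
      rw [h3, zero_mul] at e1
      exact (mul_eq_zero.1 e1).resolve_left h0
    rw [this]
    ring
  refine mul_right_cancel₀ (mul_ne_zero h0 h3) ?_
  linear_combination (marginal q C x * marginal p (insert a C) x) * e2
    + (marginal q (insert b (insert a C)) x * marginal p (insert a C) x) * e1

/-- The pair `a`, `b` has the same conditional distribution given the parents of `a`. Summing out
`a` settles `b`, and dividing by the result settles `a`. -/
theorem IsCovered.sameConditional_reverseEdge (h : IsCovered D a b) (hD : IsDAG D)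
    {p q : (∀ v, X v) → ℝ} (hp : ∀ x, 0 ≤ p x) (hq : ∀ x, 0 ≤ q x)
    (ha : SameConditional p q a (parents D a)) (hb : SameConditional p q b (parents D b)) :
    SameConditional p q a (parents (reverseEdge D a b) a) ∧
    SameConditional p q b (parents (reverseEdge D a b) b) := by
  have hne := h.ne hD
  rw [h] at hb
  have hc := SameConditional.chain hp hq ha hb
  rw [h.parents_left hD, h.parents_right hD]
  have haC : a ∉ parents D a := hD.irrefl a
  have haC' : a ∉ insert b (parents D a) := fun hmem =>
      (Set.mem_insert_iff.1 hmem).elim hne haC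
  have hbC : ∀ x, marginal p (insert b (parents D a)) x * marginal q (parents D a) x
      = marginal q (insert b (parents D a)) x * marginal p (parents D a) x := by
    refine sum_out_eq haC' haC' haC haC ?_
    intro x
    rw [Set.insert_comm]
    exact hc x
  refine ⟨fun x => ?_, fun x => ?_⟩
  · rw [Set.singleton_union, Set.insert_comm]
    by_cases h0 : marginal p (parents D a) x = 0
    · rw [marginal_eq_zero hp (Set.subset_insert b _) h0,
        marginal_eq_zero hp ((Set.subset_insert a _).trans (Set.subset_insert b _)) h0]
      ring
    by_cases h1 : marginal q (parents D a) x = 0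
    · rw [marginal_eq_zero hq (Set.subset_insert b _) h1,
        marginal_eq_zero hq ((Set.subset_insert a _).trans (Set.subset_insert b _)) h1]
      ring
    refine mul_right_cancel₀ (mul_ne_zero h0 h1) ?_
    linear_combination (marginal q (insert b (parents D a)) x * marginal p (parents D a) x) * hc x
      - (marginal q (insert b (insert a (parents D a))) x * marginal p (parents D a) x) * hbC x
  · rw [Set.singleton_union]
    exact hbC x

/-- An intervention that does not cut the edge targets both ends, and then the reversal is invisible
in the intervention graph, or neither, and then the edge is still covered there. -/
theorem IsCovered.isInterventionalFamily_reverseEdge (h : IsCovered D a b) (hD : IsDAG D)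
    {𝓘 : Set (Set V)} (hI : ∀ I ∈ 𝓘, a ∈ I ↔ b ∈ I) {P : Set V → (∀ v, X v) → ℝ}
    (hP : IsInterventionalFamily 𝓘 D P) : IsInterventionalFamily 𝓘 (reverseEdge D a b) P := by
  have hI' : ∀ I ∈ 𝓘 ∪ {∅}, a ∈ I ↔ b ∈ I := by
    rintro I (hm | hm)
    · exact hI I hm
    · rw [Set.mem_singleton_iff.1 hm]
      simp
  refine ⟨fun I hm => ⟨(hP.1 I hm).1, ?_⟩, fun I hm J hm' v hv hv' => ?_⟩
  · by_cases ha : a ∈ I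
    · rw [intervention_reverseEdge_of_mem ha ((hI' I hm).1 ha)]
      exact (hP.1 I hm).2
    · rw [intervention_reverseEdge ha]
      exact (h.intervention ha (fun hb => ha ((hI' I hm).2 hb))).isMarkov_reverseEdge
        (hD.intervention I) (hP.1 I hm).1 (hP.1 I hm).2
  · have hs : a ∉ I → a ∉ J → SameConditional (P I) (P J) a (parents (reverseEdge D a b) a) ∧
        SameConditional (P I) (P J) b (parents (reverseEdge D a b) b) := fun h1 h2 =>
      h.sameConditional_reverseEdge hD (hP.1 I hm).1.1 (hP.1 J hm').1.1
        (hP.2 I hm J hm' a h1 h2)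
        (hP.2 I hm J hm' b (fun e => h1 ((hI' I hm).2 e)) (fun e => h2 ((hI' J hm').2 e)))
    by_cases hva : v = a
    · subst hva
      exact (hs hv hv').1
    by_cases hvb : v = b
    · subst hvb
      exact (hs (fun e => hv ((hI' I hm).1 e)) (fun e => hv' ((hI' J hm').1 e))).2
    rw [parents_reverseEdge_of_ne hva hvb]
    exact hP.2 I hm J hm' v hv hv'

omit [∀ v, Finite (X v)] in
/-- Reversing a covered edge which no intervention cuts does not leave the `𝓘`-Markov equivalence
class. -/
theorem IsCovered.iMarkovEquiv_reverseEdge (h : IsCovered D a b) (hD : IsDAG D)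
    {𝓘 : Set (Set V)} (hI : ∀ I ∈ 𝓘, a ∈ I ↔ b ∈ I) : IMarkovEquiv 𝓘 D (reverseEdge D a b) := by
  intro X _ P
  refine ⟨h.isInterventionalFamily_reverseEdge hD hI, fun hP => ?_⟩
  rw [← h.reverseEdge_reverseEdge hD]
  exact (h.reverse hD).isInterventionalFamily_reverseEdge (h.isDAG_reverseEdge hD)
    (fun I hm => (hI I hm).symm) hP

end Reversal

/-! ### Distributions that tell graphs apart -/

section Parity

variable {V : Type u}

/-- The assignments of bits to the vertices which vanish outside `S ∪ {c}` and give `c` the parity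
of the bits in `S`, unless `c` is in the set `J` of intervention targets. -/
def paritySubgroup (S : Finset V) (c : V) (J : Set V) : AddSubgroup (V → ZMod 2) where
  carrier := {y | (∀ v, v ∉ S → v ≠ c → y v = 0) ∧ (c ∉ J → y c = ∑ s ∈ S, y s)}
  zero_mem' := by simp
  add_mem' := by
    rintro y z ⟨h1, h2⟩ ⟨h3, h4⟩
    refine ⟨fun v hv hc => by simp [h1 v hv hc, h3 v hv hc], fun hc => ?_⟩
    simp [h2 hc, h4 hc, Finset.sum_add_distrib]
  neg_mem' := by
    rintro y ⟨h1, h2⟩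
    refine ⟨fun v hv hc => by simp [h1 v hv hc], fun hc => ?_⟩
    simp [h2 hc]

open Classical in
/-- The uniform distribution on `paritySubgroup S c J`. -/
noncomputable def parityDist (S : Finset V) (c : V) (J : Set V) (y : V → ZMod 2) : ℝ :=
  if y ∈ paritySubgroup S c J then (Nat.card (paritySubgroup S c J) : ℝ)⁻¹ else 0

open Classical in
/-- The conditional distributions of the family `parityDist S c`. -/
noncomputable def parityKernel (S : Finset V) (c : V) (J : Set V) (v : V) (x : V → ZMod 2) : ℝ :=
  if v ∈ S ∨ (v = c ∧ c ∈ J) then 1 / 2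
  else if v = c then (if x c = ∑ s ∈ S, x s then 1 else 0)
  else if x v = 0 then 1 else 0

variable [Finite V]

theorem parityDist_ne_zero {S : Finset V} {c : V} {J : Set V} {y : V → ZMod 2} :
    parityDist S c J y ≠ 0 ↔ y ∈ paritySubgroup S c J := by
  have : Nat.card (paritySubgroup S c J) ≠ 0 := Nat.card_pos.ne'
  rw [parityDist]
  split_ifs with h <;> simp [h, this]

theorem isDistribution_parityDist (S : Finset V) (c : V) (J : Set V) :
    IsDistribution (X := fun _ : V => ZMod 2) (parityDist S c J) := by
  classical
  have := Fintype.ofFinite V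
  refine ⟨fun y => ?_, ?_⟩
  · rw [parityDist]
    split_ifs <;> positivity
  · rw [finsum_eq_sum_of_fintype]
    simp only [parityDist]
    rw [Finset.sum_ite, Finset.sum_const_zero, add_zero, Finset.sum_const, nsmul_eq_mul]
    have hc : (Finset.univ.filter fun y => y ∈ paritySubgroup S c J).card
        = Nat.card (paritySubgroup S c J) := by
      rw [Nat.card_eq_fintype_card, Fintype.card_subtype]
    rw [hc]
    exact mul_inv_cancel₀ (Nat.cast_ne_zero.2 Nat.card_pos.ne')

theorem marginal_insert_of_determined {X : V → Type} [∀ v, Finite (X v)] [∀ v, DecidableEq (X v)]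
    {p : (∀ v, X v) → ℝ} {Z : Set V} {v : V} {x : ∀ v, X v} {g : X v}
    (h : ∀ y, p y ≠ 0 → (∀ u ∈ Z, y u = x u) → y v = g) :
    marginal p (insert v Z) x = (if x v = g then 1 else 0) * marginal p Z x := by
  classical
  have := Fintype.ofFinite (∀ v, X v)
  rw [marginal_eq_sum, marginal_eq_sum, Finset.mul_sum]
  refine Finset.sum_congr rfl fun y _ => ?_
  by_cases h0 : p y = 0
  · simp [h0]
  by_cases hZ : ∀ u ∈ Z, y u = x u
  · have := h y h0 hZ
    rw [if_pos hZ]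
    by_cases hg : x v = g
    · rw [if_pos, if_pos hg, one_mul]
      intro u hu
      rcases Set.mem_insert_iff.1 hu with rfl | hu
      · rw [this, hg]
      · exact hZ u hu
    · rw [if_neg, if_neg hg, zero_mul]
      intro hh
      exact hg (by rw [← hh v (Set.mem_insert _ _), this])
  · rw [if_neg hZ, if_neg, mul_zero]
    exact fun hh => hZ fun u hu => hh u (Set.mem_insert_of_mem _ hu)

/-- Translation by `d` preserves `p`, flips `v` and fixes `Z`, so both values of `v` are equally
likely given `Z`. -/
theorem marginal_insert_of_shift {p : (V → ZMod 2) → ℝ} {Z : Set V} {v : V} {d : V → ZMod 2}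
    (hv : v ∉ Z) (hd : ∀ u ∈ Z, d u = 0) (hdv : d v = 1) (hp : ∀ y, p (y + d) = p y)
    (x : V → ZMod 2) :
    marginal (X := fun _ => ZMod 2) p (insert v Z) x
      = 1 / 2 * marginal (X := fun _ => ZMod 2) p Z x := by
  classical
  have := Fintype.ofFinite V
  have hs : ∀ x : V → ZMod 2, marginal (X := fun _ => ZMod 2) p (insert v Z) (x + d)
      = marginal (X := fun _ => ZMod 2) p (insert v Z) x := by
    intro x
    rw [marginal_eq_sum, marginal_eq_sum, ← Equiv.sum_comp (Equiv.addRight d)]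
    refine Finset.sum_congr rfl fun y _ => ?_
    simp [hp]
  have ht : ∀ t : ZMod 2, marginal (X := fun _ => ZMod 2) p (insert v Z) (Function.update x v t)
      = marginal (X := fun _ => ZMod 2) p (insert v Z) x := by
    intro t
    have h2 : ∀ s t : ZMod 2, t = s ∨ t = s + 1 := by decide
    rcases h2 (x v) t with rfl | rfl
    · rw [Function.update_eq_self]
    · rw [← hs x]
      refine marginal_congr _ fun u hu => ?_
      rcases Set.mem_insert_iff.1 hu with rfl | hu
      · simp [hdv]
      · have : u ≠ v := fun e => hv (e ▸ hu)
        simp [this, hd u hu]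
  rw [marginal_sum_out (X := fun _ => ZMod 2) p hv]
  simp_rw [ht]
  simp [ZMod.card]

/-- Unless `c` is targeted, `c` is determined once `Z` contains `S`, and a bit in `S` is free as
long as `Z` omits `c`. Any `Z` between the parents and the non-descendants of `v` in an intervention
graph meets these conditions if `S` consists of parents of `c`. -/
theorem marginal_parityDist {S : Finset V} {c : V} (hcS : c ∉ S) {J : Set V} {v : V} {Z : Set V}
    (hv : v ∉ Z) (hS : v = c → c ∉ J → (S : Set V) ⊆ Z) (hc : v ∈ S → c ∉ J → c ∉ Z)
    (x : V → ZMod 2) :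
    marginal (X := fun _ => ZMod 2) (parityDist S c J) (insert v Z) x
      = parityKernel S c J v x * marginal (X := fun _ => ZMod 2) (parityDist S c J) Z x := by
  classical
  have shift : ∀ d ∈ paritySubgroup S c J, ∀ y,
      parityDist S c J (y + d) = parityDist S c J y := by
    intro d hd y
    simp only [parityDist]
    rw [AddSubgroup.add_mem_cancel_right _ hd]
  by_cases h1 : v ∈ S ∨ (v = c ∧ c ∈ J)
  · rw [parityKernel, if_pos h1]
    rcases h1 with h1 | ⟨rfl, h1⟩
    · have hvc : v ≠ c := fun e => hcS (e ▸ h1)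
      by_cases hJ : c ∈ J
      · refine marginal_insert_of_shift (d := Pi.single v 1) hv ?_ (by simp) (shift _ ?_) x
        · intro u hu
          have : u ≠ v := fun e => hv (e ▸ hu)
          simp [this]
        · refine ⟨fun u hu _ => ?_, fun h => absurd hJ h⟩
          have : u ≠ v := fun e => hu (e ▸ h1)
          simp [this]
      -- Flipping `c` along with `v` maintains the parity equation.
      · refine marginal_insert_of_shift (d := Pi.single v 1 + Pi.single c 1) hv ?_
          (by simp [hvc]) (shift _ ?_) x
        · intro u hu
          have h2 : u ≠ v := fun e => hv (e ▸ hu)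
          have h3 : u ≠ c := fun e => hc h1 hJ (e ▸ hu)
          simp [h2, h3]
        · refine ⟨fun u hu huc => ?_, fun _ => ?_⟩
          · have : u ≠ v := fun e => hu (e ▸ h1)
            simp [this, huc]
          · have h3 : ∀ s ∈ S, (Pi.single c 1 : V → ZMod 2) s = 0 := by
              intro s hs
              have : s ≠ c := fun e => hcS (e ▸ hs)
              simp [this]
            simp only [Pi.add_apply, Finset.sum_add_distrib]
            rw [Finset.sum_eq_zero h3, Finset.sum_eq_single v]
            · simp [hvc.symm]
            · exact fun s _ hs => by simp [hs]
            · exact fun h => absurd h1 h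
    · refine marginal_insert_of_shift (d := Pi.single v 1) hv ?_ (by simp) (shift _ ?_) x
      · intro u hu
        have : u ≠ v := fun e => hv (e ▸ hu)
        simp [this]
      · exact ⟨fun u _ hu => by simp [hu], fun h => absurd h1 h⟩
  · rw [parityKernel, if_neg h1]
    push Not at h1
    by_cases hvc : v = c
    · subst hvc
      rw [if_pos rfl]
      refine marginal_insert_of_determined (X := fun _ => ZMod 2) fun y hy hyx => ?_
      rw [(parityDist_ne_zero.1 hy).2 (h1.2 rfl)]
      exact Finset.sum_congr rfl fun s hs => hyx s (hS rfl (h1.2 rfl) hs)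
    · rw [if_neg hvc]
      refine marginal_insert_of_determined (X := fun _ => ZMod 2) fun y hy _ => ?_
      exact (parityDist_ne_zero.1 hy).1 v h1.1 hvc

/-- The kernels depend on the intervention only through whether `c` is targeted, and this affects
`c` alone. -/
theorem isInterventionalFamily_parityDist {D : Digraph V} (hD : IsDAG D) {S : Finset V} {c : V}
    (hS : (S : Set V) ⊆ parents D c) (𝓘 : Set (Set V)) :
    IsInterventionalFamily (X := fun _ : V => ZMod 2) 𝓘 D (parityDist S c) := by
  have hcS : c ∉ S := fun h => hD.irrefl c (hS h)
  have hpar : ∀ {J : Set V} {v : V}, v ∉ J → parents (interventionGraph D J) v = parents D v := by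
    intro J v hv
    ext u
    simp [parents, interventionGraph, hv]
  have key : ∀ (J : Set V) (v : V) (Z : Set V), parents (interventionGraph D J) v ⊆ Z →
      Z ⊆ nonDescendants (interventionGraph D J) v → ∀ x,
      marginal (X := fun _ => ZMod 2) (parityDist S c J) (insert v Z) x
      = parityKernel S c J v x * marginal (X := fun _ => ZMod 2) (parityDist S c J) Z x := by
    intro J v Z h1 h2 x
    refine marginal_parityDist hcS (fun h => (h2 h).1 rfl) ?_ ?_ x
    · rintro rfl hJ
      exact fun s hs => h1 (by rw [hpar hJ]; exact hS hs)
    · exact fun hv hJ hZ => (h2 hZ).2 (.single ⟨hS hv, hJ⟩)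
  refine ⟨fun J _ => ⟨isDistribution_parityDist S c J, ?_⟩, fun I _ J _ v hvI hvJ x => ?_⟩
  · rw [isMarkov_iff (hD.intervention J)]
    intro v x
    have hsub := (hD.intervention J).parents_subset v
    rw [key J v _ hsub le_rfl, key J v _ le_rfl hsub]
    ring
  · have hI := key I v _ le_rfl ((hD.intervention I).parents_subset v) x
    have hJ := key J v _ le_rfl ((hD.intervention J).parents_subset v) x
    rw [hpar hvI] at hI
    rw [hpar hvJ] at hJ
    have hk : parityKernel S c I v x = parityKernel S c J v x := by
      have hiff : v ∈ S ∨ (v = c ∧ c ∈ I) ↔ v ∈ S ∨ (v = c ∧ c ∈ J) := by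
        refine or_congr_right (and_congr_right ?_)
        rintro rfl
        exact iff_of_false hvI hvJ
      by_cases h : v ∈ S ∨ (v = c ∧ c ∈ I)
      · rw [parityKernel, parityKernel, if_pos h, if_pos (hiff.1 h)]
      · rw [parityKernel, parityKernel, if_neg h, if_neg fun h' => h (hiff.2 h')]
    rw [Set.singleton_union, hI, hJ, hk]
    ring

theorem marginal_ne_zero_iff {X : V → Type} [∀ v, Finite (X v)] {p : (∀ v, X v) → ℝ}
    (hp : ∀ x, 0 ≤ p x) {Z : Set V} {x : ∀ v, X v} :
    marginal p Z x ≠ 0 ↔ ∃ y, p y ≠ 0 ∧ ∀ v ∈ Z, y v = x v := by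
  classical
  have := Fintype.ofFinite (∀ v, X v)
  rw [marginal_eq_sum, Ne, Finset.sum_eq_zero_iff_of_nonneg]
  · simp only [Finset.mem_univ, true_implies, ite_eq_right_iff, not_forall]
    exact exists_congr fun y => ⟨fun ⟨a, b⟩ => ⟨b, a⟩, fun ⟨a, b⟩ => ⟨b, a⟩⟩
  · intro y _
    split_ifs
    · exact hp y
    · exact le_rfl

/-- Two possible values that agree on the parents of `v` can be combined: the value of `v` from the
one and the values of its non-descendants from the other. -/
theorem IsMarkov.exists_combination {X : V → Type} [∀ v, Finite (X v)] {D : Digraph V}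
    (hD : IsDAG D) {p : (∀ v, X v) → ℝ} (hp : ∀ x, 0 ≤ p x) (hM : IsMarkov D p) {v : V}
    {y z : ∀ v, X v} (hy : p y ≠ 0) (hz : p z ≠ 0) (hyz : ∀ u ∈ parents D v, y u = z u) :
    ∃ w, p w ≠ 0 ∧ w v = y v ∧ ∀ u ∈ nonDescendants D v, w u = z u := by
  classical
  rw [isMarkov_iff hD] at hM
  have h := hM v (Function.update z v (y v))
  have hu : ∀ u ∈ nonDescendants D v, Function.update z v (y v) u = z u := by
    intro u hu
    simp [hu.1]
  have h1 : marginal p (nonDescendants D v) (Function.update z v (y v)) ≠ 0 :=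
    (marginal_ne_zero_iff hp).2 ⟨z, hz, fun u hm => (hu u hm).symm⟩
  have h2 : marginal p (insert v (parents D v)) (Function.update z v (y v)) ≠ 0 := by
    refine (marginal_ne_zero_iff hp).2 ⟨y, hy, fun u hm => ?_⟩
    rcases Set.mem_insert_iff.1 hm with rfl | hm
    · simp
    · rw [hu u (hD.parents_subset v hm), hyz u hm]
  have h3 := left_ne_zero_of_mul (h ▸ mul_ne_zero h1 h2)
  obtain ⟨w, hw, hwx⟩ := (marginal_ne_zero_iff hp).1 h3
  refine ⟨w, hw, ?_, fun u hm => ?_⟩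
  · simpa using hwx v (Set.mem_insert _ _)
  · rw [hwx u (Set.mem_insert_of_mem _ hm), hu u hm]

/-- Under this distribution `c` copies `a`. If the two were not adjacent, one would be a
non-descendant of the other, and combining the outcomes "both `1`" and "all `0`" would give one in
which they differ. -/
theorem adj_of_isMarkov_parityDist {E : Digraph V} (hE : IsDAG E) {a c : V} (hac : a ≠ c)
    {J : Set V} (hc : c ∉ J)
    (hM : IsMarkov (X := fun _ : V => ZMod 2) E (parityDist {a} c J)) :
    E.Adj a c ∨ E.Adj c a := by
  classical
  by_contra hn
  push Not at hn
  have h0 : parityDist {a} c J 0 ≠ 0 := parityDist_ne_zero.2 (zero_mem _)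
  have h1 : parityDist {a} c J (Pi.single a 1 + Pi.single c 1) ≠ 0 := by
    refine parityDist_ne_zero.2 ⟨fun v hv hvc => ?_, fun _ => ?_⟩
    · have : v ≠ a := by simpa using hv
      simp [this, hvc]
    · simp [hac, hac.symm]
  have comb : ∀ v, (∀ u ∈ parents E v, u ≠ a ∧ u ≠ c) → ∃ w : V → ZMod 2, w c = w a ∧
      w v = (Pi.single a 1 + Pi.single c 1 : V → ZMod 2) v ∧
      ∀ u ∈ nonDescendants E v, w u = 0 := by
    intro v hv
    obtain ⟨w, hw, h2, h3⟩ := hM.exists_combination (v := v) hE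
      (isDistribution_parityDist _ _ _).1 h1 h0 (fun u hu => by simp [(hv u hu).1, (hv u hu).2])
    exact ⟨w, by simpa using (parityDist_ne_zero.1 hw).2 hc, h2, h3⟩
  by_cases hd : c ∈ nonDescendants E a
  · obtain ⟨w, h2, h3, h4⟩ := comb a fun u (hu : E.Adj u a) =>
      ⟨fun e => hE.irrefl a (e ▸ hu), fun e => hn.2 (e ▸ hu)⟩
    rw [h4 c hd] at h2
    rw [← h2] at h3
    simp [hac] at h3
  · have hd' : a ∈ nonDescendants E c := by
      refine ⟨hac, fun t => hd ⟨hac.symm, fun t' => hE a (t'.trans t)⟩⟩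
    obtain ⟨w, h2, h3, h4⟩ := comb c fun u (hu : E.Adj u c) =>
      ⟨fun e => hn.1 (e ▸ hu), fun e => hE.irrefl c (e ▸ hu)⟩
    rw [h4 a hd'] at h2
    rw [h2] at h3
    simp [hac.symm] at h3

/-- Here `c` is the sum of `a` and `b`. If `c → a`, the outcome `a = b = 1`, `c = 0` combines with
the zero outcome, at `a` or at `b`, into one where exactly one of `a`, `b` is `1` while `c = 0`. -/
theorem not_adj_of_isMarkov_parityDist [DecidableEq V] {E : Digraph V} (hE : IsDAG E) {a b c : V}
    (hab : a ≠ b) (hac : a ≠ c) (hbc : b ≠ c) (h1 : ¬ E.Adj a b) (h2 : ¬ E.Adj b a)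
    (hM : IsMarkov (X := fun _ : V => ZMod 2) E (parityDist {a, b} c ∅)) :
    ¬ E.Adj c a := by
  intro hca
  have h0 : parityDist {a, b} c ∅ 0 ≠ 0 := parityDist_ne_zero.2 (zero_mem _)
  have h11 : (1 + 1 : ZMod 2) = 0 := by decide
  have h3 : parityDist {a, b} c ∅ (Pi.single a 1 + Pi.single b 1) ≠ 0 := by
    refine parityDist_ne_zero.2 ⟨fun v hv hvc => ?_, fun _ => ?_⟩
    · have : v ≠ a ∧ v ≠ b := by simpa using hv
      simp [this.1, this.2]
    · rw [Finset.sum_pair hab]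
      simp [hab, hab.symm, hac.symm, hbc.symm, h11]
  have comb : ∀ v, (∀ u ∈ parents E v, u ≠ a ∧ u ≠ b) → ∃ w : V → ZMod 2, w c = w a + w b ∧
      w v = (Pi.single a 1 + Pi.single b 1 : V → ZMod 2) v ∧
      ∀ u ∈ nonDescendants E v, w u = 0 := by
    intro v hv
    obtain ⟨w, hw, h4, h5⟩ := hM.exists_combination (v := v) hE
      (isDistribution_parityDist _ _ _).1 h3 h0 (fun u hu => by simp [(hv u hu).1, (hv u hu).2])
    refine ⟨w, ?_, h4, h5⟩
    have := (parityDist_ne_zero.1 hw).2 (Set.notMem_empty c)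
    rwa [Finset.sum_pair hab] at this
  by_cases hd : b ∈ nonDescendants E a
  · obtain ⟨w, h4, h5, h6⟩ := comb a fun u (hu : E.Adj u a) =>
      ⟨fun e => hE.irrefl a (e ▸ hu), fun e => h2 (e ▸ hu)⟩
    rw [h6 b hd, h6 c (hE.parents_subset a hca), add_zero] at h4
    rw [← h4] at h5
    simp [hab] at h5
  · have ht : Relation.TransGen E.Adj a b := by
      by_contra t
      exact hd ⟨hab.symm, t⟩
    have hd' : a ∈ nonDescendants E b := ⟨hab, fun t => hE a (ht.trans t)⟩
    have hd'' : c ∈ nonDescendants E b :=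
      ⟨hbc.symm, fun t => hE a (ht.trans (t.tail hca))⟩
    obtain ⟨w, h4, h5, h6⟩ := comb b fun u (hu : E.Adj u b) =>
      ⟨fun e => h1 (e ▸ hu), fun e => hE.irrefl b (e ▸ hu)⟩
    rw [h6 a hd', h6 c hd'', zero_add] at h4
    rw [← h4] at h5
    simp [hab.symm] at h5

omit [Finite V] in
theorem intervention_empty (D : Digraph V) : interventionGraph D ∅ = D := by
  ext u v
  simp [interventionGraph]

/-- The graphs `D` and `D'` have the same edges up to direction. -/
def SameSkeleton (D D' : Digraph V) : Prop :=
  ∀ a b, D.Adj a b ∨ D.Adj b a ↔ D'.Adj a b ∨ D'.Adj b a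

omit [Finite V] in
theorem IMarkovEquiv.symm {𝓘 : Set (Set V)} {D D' : Digraph V} (h : IMarkovEquiv 𝓘 D D') :
    IMarkovEquiv 𝓘 D' D :=
  fun X _ P => (h X P).symm

omit [Finite V] in
theorem IMarkovEquiv.trans {𝓘 : Set (Set V)} {D₁ D₂ D₃ : Digraph V} (h : IMarkovEquiv 𝓘 D₁ D₂)
    (h' : IMarkovEquiv 𝓘 D₂ D₃) : IMarkovEquiv 𝓘 D₁ D₃ :=
  fun X _ P => (h X P).trans (h' X P)

theorem IMarkovEquiv.adj_or_adj {𝓘 : Set (Set V)} {D D' : Digraph V} (hD : IsDAG D)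
    (hD' : IsDAG D') (h : IMarkovEquiv 𝓘 D D') {a b : V} (hab : D.Adj a b) :
    D'.Adj a b ∨ D'.Adj b a := by
  have hne : a ≠ b := fun e => hD.irrefl a (by simpa [e] using hab)
  have hF := isInterventionalFamily_parityDist hD (S := {a}) (c := b)
    (by simpa [parents] using hab) 𝓘
  have hM := (((h _ _).1 hF).1 ∅ (Or.inr rfl)).2
  rw [intervention_empty] at hM
  exact adj_of_isMarkov_parityDist hD' hne (Set.notMem_empty b) hM

theorem IMarkovEquiv.sameSkeleton {𝓘 : Set (Set V)} {D D' : Digraph V} (hD : IsDAG D)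
    (hD' : IsDAG D') (h : IMarkovEquiv 𝓘 D D') : SameSkeleton D D' := fun _ _ =>
  ⟨fun e => e.elim (h.adj_or_adj hD hD') (fun e => (h.adj_or_adj hD hD' e).symm),
    fun e => e.elim (h.symm.adj_or_adj hD' hD) (fun e => (h.symm.adj_or_adj hD' hD e).symm)⟩

/-- If only `a` is targeted, `b` still copies `a`, and the intervention graph of `D'` has no edge
into `a`. If only `b` is targeted, the same argument from `D'` to `D` excludes `b → a`. -/
theorem IMarkovEquiv.adj_of_cut {𝓘 : Set (Set V)} {D D' : Digraph V} (hD : IsDAG D)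
    (hD' : IsDAG D') (h : IMarkovEquiv 𝓘 D D') {a b : V} (hab : D.Adj a b) {I : Set V}
    (hI : I ∈ 𝓘) (hcut : ¬ (a ∈ I ↔ b ∈ I)) : D'.Adj a b := by
  have aux : ∀ {D D' : Digraph V}, IsDAG D → IsDAG D' → IMarkovEquiv 𝓘 D D' → ∀ {a b : V},
      D.Adj a b → a ∈ I → b ∉ I → D'.Adj a b := by
    intro D D' hD hD' h a b hab ha hb
    have hne : a ≠ b := fun e => hD.irrefl a (by simpa [e] using hab)
    have hF := isInterventionalFamily_parityDist hD (S := {a}) (c := b)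
      (by simpa [parents] using hab) 𝓘
    have hM := (((h _ _).1 hF).1 I (Or.inl hI)).2
    rcases adj_of_isMarkov_parityDist (hD'.intervention I) hne hb hM with e | e
    · exact e.1
    · exact absurd ha e.2
  by_cases ha : a ∈ I
  · exact aux hD hD' h hab ha (fun hb => hcut (iff_of_true ha hb))
  · have hb : b ∈ I := by
      by_contra hb
      exact hcut (iff_of_false ha hb)
    rcases h.adj_or_adj hD hD' hab with e | e
    · exact e
    · exact absurd (aux hD' hD h.symm e hb ha) (hD.asymm hab)

theorem IMarkovEquiv.not_adj_of_collider {𝓘 : Set (Set V)} {D D' : Digraph V} (hD : IsDAG D)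
    (hD' : IsDAG D') (h : IMarkovEquiv 𝓘 D D') {a b c : V} (hac : D.Adj a c) (hbc : D.Adj b c)
    (hab : a ≠ b) (hn : ¬ D.Adj a b) (hn' : ¬ D.Adj b a) : ¬ D'.Adj c a := by
  classical
  have hF := isInterventionalFamily_parityDist hD (S := {a, b}) (c := c)
    (by
      intro s hs
      rcases (by simpa using hs : s = a ∨ s = b) with rfl | rfl
      · exact hac
      · exact hbc) 𝓘
  have hM := (((h _ _).1 hF).1 ∅ (Or.inr rfl)).2
  rw [intervention_empty] at hM
  have hs := h.sameSkeleton hD hD' a b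
  refine not_adj_of_isMarkov_parityDist hD' hab ?_ ?_ ?_ ?_ hM
  · exact fun e => hD.irrefl a (by simpa [e] using hac)
  · exact fun e => hD.irrefl b (by simpa [e] using hbc)
  · exact fun e => (hs.2 (Or.inl e)).elim hn hn'
  · exact fun e => (hs.2 (Or.inr e)).elim hn hn'

omit [Finite V] in
theorem isInterventionalFamily_empty {X : V → Type} {D : Digraph V}
    {P : Set V → (∀ v, X v) → ℝ} :
    IsInterventionalFamily ∅ D P ↔ IsDistribution (P ∅) ∧ IsMarkov D (P ∅) := by
  rw [IsInterventionalFamily]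
  simp only [Set.empty_union, Set.mem_singleton_iff, forall_eq, intervention_empty]
  refine ⟨fun h => h.1, fun h => ⟨h, fun v _ _ x => rfl⟩⟩

omit [Finite V] in
-- Makes the results on interventions apply to ordinary essential graphs.
theorem markovEquiv_iff {D D' : Digraph V} : MarkovEquiv D D' ↔ IMarkovEquiv ∅ D D' := by
  refine ⟨fun h X _ P => ?_, fun h X _ p hp => ?_⟩
  · rw [isInterventionalFamily_empty, isInterventionalFamily_empty]
    exact and_congr_right fun hp => h X _ hp
  · have := h X (fun _ => p)
    rw [isInterventionalFamily_empty, isInterventionalFamily_empty] at this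
    exact (and_congr_right_iff.1 this) hp

omit [Finite V] in
theorem essentialGraph_eq (D : Digraph V) : essentialGraph D = iEssentialGraph ∅ D := by
  rw [essentialGraph, iEssentialGraph]
  simp_rw [markovEquiv_iff]

end Parity

/-! ### Orientations without colliders -/

section Orientations

variable {V : Type u}

/-- A graph is moral if any two parents of a vertex are adjacent. -/
def IsMoral (D : Digraph V) : Prop :=
  ∀ a b c, D.Adj a c → D.Adj b c → a ≠ b → D.Adj a b ∨ D.Adj b a

/-- The acyclic moral orientations of an undirected graph. -/
def orientations (G : SimpleGraph V) : Set (Digraph V) :=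
  {D | IsDAG D ∧ IsMoral D ∧ ∀ a b, G.Adj a b ↔ D.Adj a b ∨ D.Adj b a}

theorem SameSkeleton.symm {D D' : Digraph V} (h : SameSkeleton D D') : SameSkeleton D' D :=
  fun a b => (h a b).symm

theorem SameSkeleton.trans {D₁ D₂ D₃ : Digraph V} (h : SameSkeleton D₁ D₂)
    (h' : SameSkeleton D₂ D₃) : SameSkeleton D₁ D₃ :=
  fun a b => (h a b).trans (h' a b)

theorem sameSkeleton_of_mem {G : SimpleGraph V} {D D' : Digraph V} (hD : D ∈ orientations G)
    (hD' : D' ∈ orientations G) : SameSkeleton D D' :=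
  fun a b => (hD.2.2 a b).symm.trans (hD'.2.2 a b)

variable [Finite V]

theorem IMarkovEquiv.isMoral {𝓘 : Set (Set V)} {D D' : Digraph V} (hD : IsDAG D)
    (hD' : IsDAG D') (h : IMarkovEquiv 𝓘 D D') (hm : IsMoral D) : IsMoral D' := by
  intro a b c hac hbc hab
  by_contra hn
  push Not at hn
  have hs := h.symm.sameSkeleton hD' hD
  have h1 := h.symm.not_adj_of_collider hD' hD hac hbc hab hn.1 hn.2
  have h2 := h.symm.not_adj_of_collider hD' hD hbc hac hab.symm hn.2 hn.1
  have h3 := ((hs a c).1 (Or.inl hac)).resolve_right h1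
  have h4 := ((hs b c).1 (Or.inl hbc)).resolve_right h2
  exact ((hs a b).2 (hm a b c h3 h4 hab)).elim hn.1 hn.2

theorem IMarkovEquiv.mem_orientations {𝓘 : Set (Set V)} {G : SimpleGraph V} {D D' : Digraph V}
    (hD : D ∈ orientations G) (hD' : IsDAG D') (h : IMarkovEquiv 𝓘 D D') :
    D' ∈ orientations G :=
  ⟨hD', h.isMoral hD.1 hD' hD.2.1, fun a b => (hD.2.2 a b).trans (h.sameSkeleton hD.1 hD' a b)⟩

/-- Two different acyclic moral orientations differ in an edge that is covered in the first one. -/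
theorem exists_covered_edge {D D' : Digraph V} (hD : IsDAG D) (hD' : IsDAG D') (hm : IsMoral D)
    (hm' : IsMoral D') (hs : SameSkeleton D D') {u v : V} (huv : D.Adj u v) (hvu : D'.Adj v u) :
    ∃ a b, IsCovered D a b ∧ D'.Adj b a := by
  -- Among the edges on which the graphs disagree, take an earliest head `y` in `D`, and then a
  -- latest tail `x` among those pointing to `y`.
  obtain ⟨y, ⟨x₀, hx₀⟩, hy⟩ := hD.exists_source (A := {y | ∃ x, D.Adj x y ∧ D'.Adj y x})
    ⟨v, u, huv, hvu⟩
  obtain ⟨x, ⟨hxy, hyx⟩, hx⟩ := hD.exists_last (A := {x | D.Adj x y ∧ D'.Adj y x}) ⟨x₀, hx₀⟩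
  refine ⟨x, y, ?_, hyx⟩
  have hpres : ∀ {z w}, D.Adj z w → Relation.TransGen D.Adj w y → D'.Adj z w := by
    intro z w hzw hwy
    rcases (hs z w).1 (Or.inl hzw) with h | h
    · exact h
    · exact absurd hwy (hy w ⟨z, hzw, h⟩)
  ext z
  refine ⟨fun (hzy : D.Adj z y) => ?_, fun h => ?_⟩
  · by_cases hzx : z = x
    · exact Or.inl hzx
    refine Or.inr ?_
    rcases hm z x y hzy hxy hzx with h | h
    · exact h
    -- With `x → z` in both graphs, acyclicity of `D'` gives `y → z` there, so `z` would be a later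
    -- tail than `x`.
    exfalso
    have h1 := hpres h (.single hzy)
    have h2 : D'.Adj y z := ((hs z y).1 (Or.inl hzy)).resolve_left fun h2 =>
      hD' y (.tail (.tail (.single hyx) h1) h2)
    exact hx z ⟨hzy, h2⟩ (.single h)
  · rcases Set.mem_insert_iff.1 h with rfl | (h : D.Adj z x)
    · exact hxy
    have h1 := hpres h (.single hxy)
    have hzy : z ≠ y := fun e => hD.asymm hxy (e ▸ h)
    have h2 : D.Adj z y ∨ D.Adj y z := (hs z y).2 (hm' z y x h1 hyx hzy)
    exact h2.resolve_right fun h2 => hD x (.tail (.tail (.single hxy) h2) h)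

/-- While the graphs differ, some covered edge of `D` is reversed in `D'`. No intervention cuts it,
so reversing it stays in the class and lowers the number of disagreements. -/
theorem iMarkovEquiv_of_sameSkeleton {𝓘 : Set (Set V)} {D D' : Digraph V} (hD : IsDAG D)
    (hD' : IsDAG D') (hm : IsMoral D) (hm' : IsMoral D') (hs : SameSkeleton D D')
    (hcut : ∀ I ∈ 𝓘, ∀ a b, D.Adj a b → ¬ (a ∈ I ↔ b ∈ I) → D'.Adj a b) :
    IMarkovEquiv 𝓘 D D' := by
  induction hn : {e : V × V | D.Adj e.1 e.2 ∧ D'.Adj e.2 e.1}.ncard using Nat.strong_induction_on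
    generalizing D with
  | _ n ih =>
    by_cases he : ∃ u v, D.Adj u v ∧ D'.Adj v u
    · obtain ⟨u, v, huv, hvu⟩ := he
      obtain ⟨a, b, hc, hba⟩ := exists_covered_edge hD hD' hm hm' hs huv hvu
      have hIab : ∀ I ∈ 𝓘, a ∈ I ↔ b ∈ I := fun I hI => by
        by_contra h
        exact hD'.asymm (hcut I hI a b hc.adj h) hba
      have heq := hc.iMarkovEquiv_reverseEdge hD hIab
      have hR := hc.isDAG_reverseEdge hD
      refine heq.trans (ih _ ?_ hR (heq.isMoral hD hR hm)
        ((heq.sameSkeleton hD hR).symm.trans hs) ?_ rfl)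
      · rw [← hn]
        refine Set.ncard_lt_ncard ⟨?_, fun h => ?_⟩ (Set.toFinite _)
        · rintro ⟨x, y⟩ ⟨h | ⟨h1, h2⟩, h'⟩
          · exact ⟨h.1, h'⟩
          · simp only at h1 h2 h'
            subst h1 h2
            exact absurd h' (hD'.asymm hba)
        · rcases (h (show (a, b) ∈ _ from ⟨hc.adj, hba⟩)).1 with h | h
          · exact h.2 ⟨rfl, rfl⟩
          · exact hc.ne hD h.1
      · rintro I hI x y (h | ⟨rfl, rfl⟩) hxy
        · exact hcut I hI x y h.1 hxy
        · exact absurd (hIab I hI).symm hxy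
    · have : D = D' := by
        ext u v
        refine ⟨fun h => ((hs u v).1 (Or.inl h)).resolve_right fun h' => he ⟨u, v, h, h'⟩,
          fun h => ((hs u v).2 (Or.inl h)).resolve_right fun h' => he ⟨v, u, h', h⟩⟩
      subst this
      exact fun X _ P => Iff.rfl

end Orientations

/-! ### Perfect elimination orders -/

section Elimination

variable {V : Type u}

/-- A duplicate-free list in which the later neighbours of every vertex form a clique. -/
def IsElimination (H : SimpleGraph V) : List V → Prop
  | [] => True
  | v :: l => v ∉ l ∧ (∀ x ∈ l, ∀ y ∈ l, H.Adj v x → H.Adj v y → x ≠ y → H.Adj x y) ∧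
      IsElimination H l

theorem IsElimination.nodup {H : SimpleGraph V} : ∀ {l : List V}, IsElimination H l → l.Nodup
  | [], _ => List.nodup_nil
  | _ :: _, h => List.nodup_cons.2 ⟨h.1, h.2.2.nodup⟩

theorem isElimination_of_clique {H : SimpleGraph V} : ∀ {l : List V}, l.Nodup →
    (∀ x ∈ l, ∀ y ∈ l, x ≠ y → H.Adj x y) → IsElimination H l
  | [], _, _ => trivial
  | v :: l, hn, hc => by
    rw [List.nodup_cons] at hn
    exact ⟨hn.1, fun x hx y hy _ _ => hc x (.tail _ hx) y (.tail _ hy),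
      isElimination_of_clique hn.2 fun x hx y hy => hc x (.tail _ hx) y (.tail _ hy)⟩

/-- The only new vertex in the tail is `v`, which has no neighbour in `m`, so no vertex of `m` gains
a later neighbour. -/
theorem IsElimination.append_of_append {H : SimpleGraph V} {L L' : List V} {v : V}
    (hL : IsElimination H L) (hLL' : ∀ x, x ∈ L → x = v ∨ x ∈ L') :
    ∀ {m : List V}, IsElimination H (m ++ L') → (∀ x ∈ m, x ≠ v ∧ ¬ H.Adj x v) →
      IsElimination H (m ++ L)
  | [], _, _ => hL
  | x :: m, h, hm => by
    have hx := hm x (List.mem_cons_self ..)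
    have hsub : ∀ y ∈ m ++ L, y ≠ v → y ∈ m ++ L' := by
      intro y hy hyv
      rcases List.mem_append.1 hy with hy | hy
      · exact List.mem_append_left _ hy
      · exact List.mem_append_right _ ((hLL' y hy).resolve_left hyv)
    refine ⟨fun hmem => h.1 (hsub x hmem hx.1), fun y hy z hz hxy hxz => ?_,
      hL.append_of_append hLL' h.2.2 fun y hy => hm y (.tail _ hy)⟩
    exact h.2.1 y (hsub y hy fun e => hx.2 (e ▸ hxy)) z (hsub z hz fun e => hx.2 (e ▸ hxz)) hxy hxz

/-- Every clique can be moved to the end of an elimination order. -/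
theorem IsElimination.exists_append_clique {H : SimpleGraph V} : ∀ {l : List V},
    IsElimination H l → ∀ {K : List V}, K.Nodup → (∀ x ∈ K, x ∈ l) →
      (∀ x ∈ K, ∀ y ∈ K, x ≠ y → H.Adj x y) →
      ∃ m, IsElimination H (m ++ K) ∧ ∀ v, v ∈ m ++ K ↔ v ∈ l
  | [], _, K, hn, hK, hc => by
    refine ⟨[], isElimination_of_clique hn hc, fun v => ⟨hK v, fun h => by simp at h⟩⟩
  | v :: l, h, K, hn, hK, hc => by
    classical
    by_cases hv : v ∈ K
    -- `R` and the rest of `K` are together all later neighbours of `v`, hence a clique. Induction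
    -- moves it to the end, where `v` can be inserted.
    · let R := l.filter fun x => H.Adj v x ∧ x ∉ K
      have hR : ∀ x, x ∈ R ↔ x ∈ l ∧ H.Adj v x ∧ x ∉ K := fun x => by simp [R]
      have hKe : ∀ x, x ∈ K.erase v ↔ x ≠ v ∧ x ∈ K := fun x => hn.mem_erase_iff
      have hN : ∀ x ∈ R ++ K.erase v, x ∈ l ∧ H.Adj v x := by
        intro x hx
        rcases List.mem_append.1 hx with hx | hx
        · exact ⟨((hR x).1 hx).1, ((hR x).1 hx).2.1⟩
        · have hx' := (hKe x).1 hx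
          exact ⟨(List.mem_cons.1 (hK x hx'.2)).resolve_left hx'.1, hc v hv x hx'.2 hx'.1.symm⟩
      have hRn : R.Nodup := h.2.2.nodup.filter _
      have hd : ∀ {K' : List V}, (∀ x ∈ K', x ∈ K) → K'.Nodup → (R ++ K').Nodup := by
        intro K' hK' hn'
        exact hRn.append hn' fun x hx hx' => ((hR x).1 hx).2.2 (hK' x hx')
      obtain ⟨m, hm, hml⟩ := h.2.2.exists_append_clique
        (hd (fun x hx => List.mem_of_mem_erase hx) (hn.erase v)) (fun x hx => (hN x hx).1)
        (fun x hx y hy hxy => h.2.1 x (hN x hx).1 y (hN y hy).1 (hN x hx).2 (hN y hy).2 hxy)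
      have hRK : ∀ x ∈ R ++ K, x = v ∨ x ∈ R ++ K.erase v := by
        intro x hx
        by_cases hxv : x = v
        · exact Or.inl hxv
        · refine Or.inr ?_
          rcases List.mem_append.1 hx with hx | hx
          · exact List.mem_append_left _ hx
          · exact List.mem_append_right _ ((hKe x).2 ⟨hxv, hx⟩)
      have hE : IsElimination H (R ++ K) := by
        refine isElimination_of_clique (hd (fun _ hx => hx) hn) fun x hx y hy hxy => ?_
        rcases hRK x hx with rfl | hx <;> rcases hRK y hy with rfl | hy
        · exact absurd rfl hxy
        · exact (hN y hy).2
        · exact (hN x hx).2.symm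
        · exact h.2.1 x (hN x hx).1 y (hN y hy).1 (hN x hx).2 (hN y hy).2 hxy
      refine ⟨m ++ R, ?_, fun x => ?_⟩
      · rw [List.append_assoc]
        refine hE.append_of_append hRK hm fun x hx => ?_
        have hxl : x ∈ l := (hml x).1 (List.mem_append_left _ hx)
        have hxv : x ≠ v := fun e => h.1 (e ▸ hxl)
        refine ⟨hxv, fun hadj => ?_⟩
        refine List.disjoint_of_nodup_append hm.nodup hx ?_
        by_cases hxK : x ∈ K
        · exact List.mem_append_right _ ((hKe x).2 ⟨hxv, hxK⟩)
        · exact List.mem_append_left _ ((hR x).2 ⟨hxl, hadj.symm, hxK⟩)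
      · have := hml x
        simp only [List.mem_append, hKe] at this
        simp only [List.mem_append, List.mem_cons, ← this]
        by_cases hxv : x = v
        · subst hxv
          simp [hv]
        · simp [hxv, or_assoc]
    · obtain ⟨m, hm, hml⟩ := h.2.2.exists_append_clique hn
        (fun x hx => (List.mem_cons.1 (hK x hx)).resolve_left fun e => hv (e ▸ hx)) hc
      refine ⟨v :: m, ⟨fun hmem => h.1 ((hml v).1 hmem), fun x hx y hy => ?_, hm⟩, fun x => ?_⟩
      · exact h.2.1 x ((hml x).1 hx) y ((hml y).1 hy)
      · rw [List.cons_append, List.mem_cons, hml, List.mem_cons]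

theorem IsElimination.adj_of_idxOf_lt [DecidableEq V] {H : SimpleGraph V} : ∀ {l : List V},
    IsElimination H l → ∀ {a b c : V}, a ∈ l → b ∈ l → l.idxOf c < l.idxOf a →
      l.idxOf c < l.idxOf b → H.Adj c a → H.Adj c b → a ≠ b → H.Adj a b
  | [], _, _, _, _, ha, _, _, _, _, _, _ => by simp at ha
  | v :: l, h, a, b, c, ha, hb, hca, hcb, h1, h2, h3 => by
    have hva : v ≠ a := by
      rintro rfl
      simp at hca
    have hvb : v ≠ b := by
      rintro rfl
      simp at hcb
    have ha' := (List.mem_cons.1 ha).resolve_left hva.symm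
    have hb' := (List.mem_cons.1 hb).resolve_left hvb.symm
    by_cases hvc : v = c
    · subst hvc
      exact h.2.1 a ha' b hb' h1 h2 h3
    · rw [List.idxOf_cons_ne _ hvc, List.idxOf_cons_ne _ hva] at hca
      rw [List.idxOf_cons_ne _ hvc, List.idxOf_cons_ne _ hvb] at hcb
      exact h.2.2.adj_of_idxOf_lt ha' hb' (by omega) (by omega) h1 h2 h3

variable [Finite V]

/-- Peel off sinks: the remaining neighbours of a sink are its parents, a clique by morality. -/
theorem exists_isElimination {H : SimpleGraph V} {E : Digraph V} (hE : E ∈ orientations H) :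
    ∃ l, IsElimination H l ∧ ∀ v, v ∈ l := by
  classical
  have key : ∀ A : Finset V, ∃ l, IsElimination H l ∧ ∀ v, v ∈ l ↔ v ∈ A := by
    intro A
    induction hn : A.card generalizing A with
    | zero => exact ⟨[], trivial, fun v => by rw [Finset.card_eq_zero.1 hn]; simp⟩
    | succ n ih =>
      obtain ⟨v, hv, hsink⟩ := hE.1.exists_sink (A := (A : Set V))
        (Finset.coe_nonempty.2 (Finset.card_pos.1 (by omega)))
      obtain ⟨l, hl, hlA⟩ := ih (A.erase v)
        (by rw [Finset.card_erase_of_mem (Finset.mem_coe.1 hv)]; omega)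
      have hpar : ∀ x ∈ l, H.Adj v x → E.Adj x v := fun x hx hvx =>
        ((hE.2.2 v x).1 hvx).resolve_left (hsink x (Finset.mem_of_mem_erase ((hlA x).1 hx)))
      refine ⟨v :: l, ⟨fun h => ?_, fun x hx y hy hvx hvy hxy => ?_, hl⟩, fun x => ?_⟩
      · simpa using (hlA v).1 h
      · exact (hE.2.2 x y).2 (hE.2.1 x y v (hpar x hx hvx) (hpar y hy hvy) hxy)
      · rw [List.mem_cons, hlA, Finset.mem_erase]
        by_cases hxv : x = v
        · subst hxv
          simpa using hv
        · simp [hxv]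
  have := Fintype.ofFinite V
  obtain ⟨l, hl, h⟩ := key Finset.univ
  exact ⟨l, hl, fun v => (h v).2 (Finset.mem_univ v)⟩

omit [Finite V] in
-- Edges point towards the earlier vertex, so the parents of a vertex are its later neighbours,
-- which form a clique.
theorem IsElimination.mem_orientations [DecidableEq V] {H : SimpleGraph V} {l : List V}
    (hl : IsElimination H l) (hall : ∀ v, v ∈ l) :
    (⟨fun a b => H.Adj a b ∧ l.idxOf b < l.idxOf a⟩ : Digraph V) ∈ orientations H := by
  refine ⟨fun v hv => ?_, fun a b c hac hbc hab => ?_, fun a b => ⟨fun h => ?_, fun h => ?_⟩⟩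
  · have key : ∀ {x y}, Relation.TransGen (fun a b => H.Adj a b ∧ l.idxOf b < l.idxOf a) x y →
        l.idxOf y < l.idxOf x := by
      intro x y h
      induction h with
      | single e => exact e.2
      | tail _ e ih => exact e.2.trans ih
    exact lt_irrefl _ (key hv)
  · have h := hl.adj_of_idxOf_lt (hall a) (hall b) hac.2 hbc.2 hac.1.symm hbc.1.symm hab
    rcases lt_trichotomy (l.idxOf a) (l.idxOf b) with h' | h' | h'
    · exact Or.inr ⟨h.symm, h'⟩
    · exact absurd ((List.idxOf_inj (hall a)).1 h') hab
    · exact Or.inl ⟨h, h'⟩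
  · rcases lt_trichotomy (l.idxOf a) (l.idxOf b) with h' | h' | h'
    · exact Or.inr ⟨h.symm, h'⟩
    · exact absurd ((List.idxOf_inj (hall a)).1 h') h.ne
    · exact Or.inl ⟨h, h'⟩
  · exact h.elim (fun h => h.1) fun h => h.1.symm

/-- In a graph with an acyclic moral orientation, every edge has either direction in some such
orientation. -/
theorem exists_orientation_adj {H : SimpleGraph V} {E : Digraph V} (hE : E ∈ orientations H)
    {a b : V} (hab : H.Adj a b) : ∃ E' ∈ orientations H, E'.Adj a b := by
  classical
  obtain ⟨l, hl, hall⟩ := exists_isElimination hE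
  -- With `a` last in the order, all its edges point away from it.
  obtain ⟨m, hm, hml⟩ := hl.exists_append_clique (K := [a]) (by simp) (by simp [hall])
    (by simp)
  refine ⟨_, hm.mem_orientations fun v => (hml v).2 (hall v), hab, ?_⟩
  have ham : a ∉ m := fun h => by
    have := hm.nodup
    simp [List.nodup_append] at this
    exact this.2 a h rfl
  have hbm : b ∈ m := by
    have := (hml b).2 (hall b)
    simpa [hab.ne.symm] using this
  rw [List.idxOf_append_of_mem hbm, List.idxOf_append_of_notMem ham]
  have := List.idxOf_lt_length_of_mem hbm
  simpa using this

end Elimination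

/-! ### Essential graphs of moral orientations -/

section Essential

variable {V : Type u}

/-- The edges of `D` whose direction follows from the interventions and the absence of colliders
and directed cycles. -/
inductive Forced (𝓘 : Set (Set V)) (D : Digraph V) : V → V → Prop
  | cut {a b : V} (I : Set V) : D.Adj a b → I ∈ 𝓘 → ¬ (a ∈ I ↔ b ∈ I) → Forced 𝓘 D a b
  | away {d a c : V} : Forced 𝓘 D d a → D.Adj a c → ¬ D.Adj d c → ¬ D.Adj c d → Forced 𝓘 D a c
  | chain {a d c : V} : Forced 𝓘 D a d → Forced 𝓘 D d c → D.Adj a c → Forced 𝓘 D a c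

variable {𝓘 : Set (Set V)} {G : SimpleGraph V} {D : Digraph V}

theorem Forced.adj {a b : V} (h : Forced 𝓘 D a b) : D.Adj a b := by
  cases h <;> assumption

/-- A forced edge into a vertex `c` comes with forced edges into all vertices that are joined to
`c` by an edge that is not forced. -/
theorem Forced.extend (hD : IsDAG D) (hm : IsMoral D) {a c b : V} (h : Forced 𝓘 D a c)
    (hcb : D.Adj c b ∨ D.Adj b c) (h1 : ¬ Forced 𝓘 D c b) (h2 : ¬ Forced 𝓘 D b c) :
    Forced 𝓘 D a b := by
  have hadj : ∀ {a c b : V}, Forced 𝓘 D a c → (D.Adj c b ∨ D.Adj b c) → ¬ Forced 𝓘 D c b →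
      ¬ Forced 𝓘 D b c → D.Adj a b ∨ D.Adj b a := by
    intro a c b h hcb h1 h2
    by_contra hn
    push Not at hn
    have hne : a ≠ b := fun e => h2 (e ▸ h)
    rcases hcb with e | e
    · exact h1 (h.away e hn.1 hn.2)
    · exact (hm a b c h.adj e hne).elim hn.1 hn.2
  have hback : ∀ {a c b : V}, Forced 𝓘 D a c → (D.Adj c b ∨ D.Adj b c) → ¬ Forced 𝓘 D b c →
      ¬ Forced 𝓘 D b a := by
    intro a c b h hcb h2 hba
    rcases hcb with e | e
    · exact hD b (.tail (.tail (.single hba.adj) h.adj) e)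
    · exact h2 (hba.chain h e)
  -- The base case works because `c` and `b` lie on the same side of `I`, so `I` cuts `a` from `b`
  -- as well. In the other cases the induction hypothesis supplies a forced edge `d → b`.
  induction h generalizing b with
  | @cut a c I hac hI hcut =>
    have h := Forced.cut I hac hI hcut
    have hcb' : c ∈ I ↔ b ∈ I := by
      by_contra hn
      rcases hcb with e | e
      · exact h1 (.cut I e hI hn)
      · exact h2 (.cut I e hI fun h => hn h.symm)
    have hab : ¬ (a ∈ I ↔ b ∈ I) := fun e => hcut (e.trans hcb'.symm)
    rcases hadj h hcb h1 h2 with e | e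
    · exact .cut I e hI hab
    · exact absurd (.cut I e hI fun h => hab h.symm) (hback h hcb h2)
  | @away d a c hda hac hdc hcd ih =>
    have h := Forced.away hda hac hdc hcd
    by_contra hn
    have hdb := ih (hadj h hcb h1 h2) hn (hback h hcb h2)
    rcases hcb with e | e
    · have hne : d ≠ c := fun e => hD.asymm hac (e ▸ hda.adj)
      exact (hm d c b hdb.adj e hne).elim hdc hcd
    · exact h2 (hdb.away e hdc hcd)
  | @chain a d c had hdc hac _ ih =>
    have h := Forced.chain had hdc hac
    have hdb := ih hcb h1 h2
    rcases hadj h hcb h1 h2 with e | e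
    · exact had.chain hdb e
    · exact absurd (.tail (.tail (.single had.adj) hdb.adj) e) (hD a)

/-- Reversing an edge obtained by `away` or `chain` would create a collider with non-adjacent
parents or a cycle in `D'`. -/
theorem Forced.adj_of_iMarkovEquiv [Finite V] {D' : Digraph V} (hD : IsDAG D) (hD' : IsDAG D')
    (hm' : IsMoral D') (h : IMarkovEquiv 𝓘 D D') {a b : V} (hab : Forced 𝓘 D a b) :
    D'.Adj a b := by
  have hs := h.sameSkeleton hD hD'
  induction hab with
  | cut I e hI hcut => exact h.adj_of_cut hD hD' e hI hcut
  | @away d a c hda hac hdc hcd ih =>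
    refine ((hs a c).1 (Or.inl hac)).resolve_right fun e => ?_
    have hne : d ≠ c := fun e => hD.asymm hac (e ▸ hda.adj)
    exact ((hs d c).2 (hm' d c a ih e hne)).elim hdc hcd
  | @chain a d c _ _ hac ih1 ih2 =>
    exact ((hs a c).1 (Or.inl hac)).resolve_right fun e =>
      hD' a (.tail (.tail (.single ih1) ih2) e)

/-- The edges of `D` that are not forced, without their directions. -/
def freePart (𝓘 : Set (Set V)) (D : Digraph V) : SimpleGraph V where
  Adj a b := (a ≠ b ∧ (D.Adj a b ∨ D.Adj b a)) ∧ ¬ Forced 𝓘 D a b ∧ ¬ Forced 𝓘 D b a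
  symm := ⟨fun _ _ h => ⟨⟨h.1.1.symm, h.1.2.symm⟩, h.2.2, h.2.1⟩⟩
  loopless := ⟨fun _ h => h.1.1 rfl⟩

theorem Forced.extend_freePart (hD : IsDAG D) (hm : IsMoral D) {a c b : V} (h : Forced 𝓘 D a c)
    (hcb : (freePart 𝓘 D).Adj c b) : Forced 𝓘 D a b :=
  h.extend hD hm hcb.1.2 hcb.2.1 hcb.2.2

/-- The forced edges of `D` together with the edges of `E`. -/
def glue (𝓘 : Set (Set V)) (D E : Digraph V) : Digraph V where
  Adj a b := Forced 𝓘 D a b ∨ E.Adj a b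

/-- The part of `D'` on the unforced edges of `D`. -/
def restrictFree (𝓘 : Set (Set V)) (D D' : Digraph V) : Digraph V where
  Adj a b := D'.Adj a b ∧ (freePart 𝓘 D).Adj a b

/-- By `hext`, a forced edge followed by a free one can be replaced by a single forced edge. So a
cycle that uses a forced edge shrinks to one of forced edges alone, impossible in `D`, and a forced
and a free edge into the same vertex have adjacent tails. -/
theorem glue_mem_orientations (hD : D ∈ orientations G) {E : Digraph V}
    (hE : E ∈ orientations (freePart 𝓘 D)) : glue 𝓘 D E ∈ orientations G := by
  have hext : ∀ {a c b : V}, Forced 𝓘 D a c → E.Adj c b ∨ E.Adj b c → Forced 𝓘 D a b :=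
    fun h e => h.extend_freePart hD.1 hD.2.1 ((hE.2.2 _ _).2 e)
  refine ⟨fun v hv => ?_, fun a b c hac hbc hab => ?_, fun a b => ?_⟩
  -- Normal form of a path: free steps first, then forced ones.
  · have key : ∀ {x y}, Relation.TransGen (glue 𝓘 D E).Adj x y → Relation.TransGen E.Adj x y ∨
        ∃ z, Relation.ReflTransGen E.Adj x z ∧ Relation.TransGen (Forced 𝓘 D) z y := by
      intro x y h
      induction h with
      | single e =>
        rcases e with e | e
        · exact Or.inr ⟨x, .refl, .single e⟩
        · exact Or.inl (.single e)
      | tail _ e ih =>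
        rcases ih with ih | ⟨z, hxz, hz⟩ <;> rcases e with e | e
        · exact Or.inr ⟨_, ih.to_reflTransGen, .single e⟩
        · exact Or.inl (ih.tail e)
        · exact Or.inr ⟨z, hxz, hz.tail e⟩
        · obtain ⟨w, hzw, hw⟩ := Relation.TransGen.tail'_iff.1 hz
          exact Or.inr ⟨z, hxz, Relation.TransGen.tail' hzw (hext hw (Or.inl e))⟩
    rcases key hv with h | ⟨z, hvz, hz⟩
    · exact hE.1 v h
    · have hzz : Relation.TransGen (Forced 𝓘 D) z z := by
        have : ∀ {w}, Relation.ReflTransGen E.Adj v w → Relation.TransGen (Forced 𝓘 D) z w := by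
          intro w hw
          induction hw with
          | refl => exact hz
          | tail _ e ih =>
            obtain ⟨t, hzt, ht⟩ := Relation.TransGen.tail'_iff.1 ih
            exact Relation.TransGen.tail' hzt (hext ht (Or.inl e))
        exact this hvz
      exact hD.1 z (Relation.TransGen.mono (fun _ _ h => h.adj) _ _ hzz)
  · have hDE : ∀ {a b}, D.Adj a b ∨ D.Adj b a → (glue 𝓘 D E).Adj a b ∨ (glue 𝓘 D E).Adj b a := by
      intro a b h
      by_cases h1 : Forced 𝓘 D a b
      · exact Or.inl (Or.inl h1)
      by_cases h2 : Forced 𝓘 D b a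
      · exact Or.inr (Or.inl h2)
      have hne : a ≠ b := by
        rintro rfl
        exact h.elim (hD.1.irrefl a) (hD.1.irrefl a)
      exact ((hE.2.2 a b).1 ⟨⟨hne, h⟩, h1, h2⟩).imp Or.inr Or.inr
    rcases hac with hac | hac <;> rcases hbc with hbc | hbc
    · exact hDE (hD.2.1 a b c hac.adj hbc.adj hab)
    · exact Or.inl (Or.inl (hext hac (Or.inr hbc)))
    · exact Or.inr (Or.inl (hext hbc (Or.inr hac)))
    · exact (hE.2.1 a b c hac hbc hab).imp Or.inr Or.inr
  · rw [hD.2.2]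
    constructor
    · intro h
      by_cases h1 : Forced 𝓘 D a b
      · exact Or.inl (Or.inl h1)
      by_cases h2 : Forced 𝓘 D b a
      · exact Or.inr (Or.inl h2)
      have hne : a ≠ b := by
        rintro rfl
        exact h.elim (hD.1.irrefl a) (hD.1.irrefl a)
      exact ((hE.2.2 a b).1 ⟨⟨hne, h⟩, h1, h2⟩).imp Or.inr Or.inr
    · rintro ((h | h) | (h | h))
      · exact Or.inl h.adj
      · exact ((hE.2.2 a b).2 (Or.inl h)).1.2
      · exact Or.inr h.adj
      · exact ((hE.2.2 a b).2 (Or.inr h)).1.2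

theorem glue_injOn :
    Set.InjOn (glue 𝓘 D) (orientations (freePart 𝓘 D)) := by
  have key : ∀ E ∈ orientations (freePart 𝓘 D), restrictFree 𝓘 D (glue 𝓘 D E) = E := by
    intro E hE
    ext a b
    refine ⟨fun h => h.1.resolve_left h.2.2.1, fun h => ⟨Or.inr h, (hE.2.2 a b).2 (Or.inl h)⟩⟩
  intro E hE E' hE' h
  rw [← key E hE, ← key E' hE', h]

variable [Finite V]

theorem iMarkovEquiv_glue (hD : D ∈ orientations G) {E : Digraph V}
    (hE : E ∈ orientations (freePart 𝓘 D)) : IMarkovEquiv 𝓘 D (glue 𝓘 D E) := by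
  have hg := glue_mem_orientations hD hE
  exact iMarkovEquiv_of_sameSkeleton hD.1 hg.1 hD.2.1 hg.2.1 (sameSkeleton_of_mem hD hg)
    fun I hI a b hab hcut => Or.inl (.cut I hab hI hcut)

/-- Morality survives the restriction: if the edge between two free parents of `c` were forced,
extending it along the other parent's free edge would force an edge into `c`. -/
theorem restrictFree_mem_orientations (hD : D ∈ orientations G) {D' : Digraph V}
    (hD' : IsDAG D') (h : IMarkovEquiv 𝓘 D D') :
    restrictFree 𝓘 D D' ∈ orientations (freePart 𝓘 D) := by
  have hm' := h.isMoral hD.1 hD' hD.2.1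
  have hs := h.sameSkeleton hD.1 hD'
  refine ⟨hD'.mono fun _ _ e => e.1, fun a b c hac hbc hab => ?_, fun a b => ⟨fun e => ?_, ?_⟩⟩
  · have e := hm' a b c hac.1 hbc.1 hab
    have hf : (freePart 𝓘 D).Adj a b := by
      refine ⟨⟨hab, (hs a b).2 e⟩, fun hF => ?_, fun hF => ?_⟩
      · exact hac.2.2.1 (hF.extend_freePart hD.1 hD.2.1 hbc.2)
      · exact hbc.2.2.1 (hF.extend_freePart hD.1 hD.2.1 hac.2)
    exact e.imp (fun e => ⟨e, hf⟩) fun e => ⟨e, hf.symm⟩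
  · exact ((hs a b).1 e.1.2).imp (fun e' => ⟨e', e⟩) fun e' => ⟨e', e.symm⟩
  · exact fun e => e.elim (fun e => e.2) fun e => e.2.symm

theorem glue_restrictFree (hD : D ∈ orientations G) {D' : Digraph V} (hD' : IsDAG D')
    (h : IMarkovEquiv 𝓘 D D') : glue 𝓘 D (restrictFree 𝓘 D D') = D' := by
  have hm' := h.isMoral hD.1 hD' hD.2.1
  ext a b
  refine ⟨fun e => e.elim (fun e => e.adj_of_iMarkovEquiv hD.1 hD' hm' h) fun e => e.1,
    fun e => ?_⟩
  by_cases h1 : Forced 𝓘 D a b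
  · exact Or.inl h1
  refine Or.inr ⟨e, ⟨fun e' => hD'.irrefl a (by simpa [← e'] using e),
    (h.sameSkeleton hD.1 hD' a b).2 (Or.inl e)⟩, h1, fun h2 => ?_⟩
  exact hD'.asymm e (h2.adj_of_iMarkovEquiv hD.1 hD' hm' h)

omit [Finite V] in
theorem iEssentialGraph_adj {a b : V} :
    (iEssentialGraph 𝓘 D).Adj a b ↔ ∃ D', (IsDAG D' ∧ IMarkovEquiv 𝓘 D D') ∧ D'.Adj a b :=
  Iff.rfl

omit [Finite V] in
theorem iEssentialGraph_congr {D' : Digraph V} (h : IMarkovEquiv 𝓘 D D') :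
    iEssentialGraph 𝓘 D = iEssentialGraph 𝓘 D' := by
  rw [iEssentialGraph, iEssentialGraph]
  congr 1
  ext D''
  exact and_congr_right fun _ => ⟨h.symm.trans, h.trans⟩

/-- The `𝓘`-essential graph consists of the forced edges and of the other edges in both
directions. -/
theorem iEssentialGraph_adj_iff (hD : D ∈ orientations G) {a b : V} :
    (iEssentialGraph 𝓘 D).Adj a b ↔ Forced 𝓘 D a b ∨ (freePart 𝓘 D).Adj a b := by
  rw [iEssentialGraph_adj]
  constructor
  · rintro ⟨D', ⟨hD', h⟩, e⟩
    rw [← glue_restrictFree hD hD' h] at e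
    exact e.imp_right fun e => e.2
  · rintro (e | e)
    · exact ⟨D, ⟨hD.1, fun X _ P => Iff.rfl⟩, e.adj⟩
    · obtain ⟨E, hE, hab⟩ := exists_orientation_adj
        (restrictFree_mem_orientations hD hD.1 fun X _ P => Iff.rfl) e
      exact ⟨glue 𝓘 D E, ⟨(glue_mem_orientations hD hE).1, iMarkovEquiv_glue hD hE⟩, Or.inr hab⟩

theorem undirectedPart_iEssentialGraph (hD : D ∈ orientations G) :
    undirectedPart (iEssentialGraph 𝓘 D) = freePart 𝓘 D := by
  ext a b
  simp only [undirectedPart, iEssentialGraph_adj_iff hD]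
  constructor
  · rintro ⟨_, h1 | h1, h2 | h2⟩
    · exact absurd h2.adj (hD.1.asymm h1.adj)
    · exact h2.symm
    · exact h1
    · exact h1
  · exact fun h => ⟨h.ne, Or.inr h, Or.inr h.symm⟩

/-- A cut edge of `D` has only one direction in the essential graph, so `D'` cannot reverse it. -/
theorem iMarkovEquiv_of_iEssentialGraph_eq {D' : Digraph V} (hD : D ∈ orientations G)
    (hD' : D' ∈ orientations G) (h : iEssentialGraph 𝓘 D' = iEssentialGraph 𝓘 D) :
    IMarkovEquiv 𝓘 D D' := by
  refine iMarkovEquiv_of_sameSkeleton hD.1 hD'.1 hD.2.1 hD'.2.1 (sameSkeleton_of_mem hD hD')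
    fun I hI a b hab hcut => ?_
  refine ((sameSkeleton_of_mem hD hD' a b).1 (Or.inl hab)).resolve_right fun hba => ?_
  have h1 : (iEssentialGraph 𝓘 D').Adj b a := ⟨D', ⟨hD'.1, fun X _ P => Iff.rfl⟩, hba⟩
  rw [h, iEssentialGraph_adj] at h1
  obtain ⟨D'', ⟨hD'', h2⟩, h3⟩ := h1
  exact hD''.asymm h3 (h2.adj_of_cut hD.1 hD'' hab hI hcut)

/-- The orientations with the same `𝓘`-essential graph as `D` correspond to the orientations of
its undirected part. -/
theorem ncard_iEssentialGraph_fiber (hD : D ∈ orientations G) :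
    {D' ∈ orientations G | iEssentialGraph 𝓘 D' = iEssentialGraph 𝓘 D}.ncard
      = (orientations (undirectedPart (iEssentialGraph 𝓘 D))).ncard := by
  rw [undirectedPart_iEssentialGraph hD, ← (glue_injOn (𝓘 := 𝓘) (D := D)).ncard_image]
  congr 1
  ext D'
  constructor
  · rintro ⟨hD', h⟩
    have h' := iMarkovEquiv_of_iEssentialGraph_eq hD hD' h
    exact ⟨_, restrictFree_mem_orientations hD hD'.1 h', glue_restrictFree hD hD'.1 h'⟩
  · rintro ⟨E, hE, rfl⟩
    exact ⟨glue_mem_orientations hD hE, (iEssentialGraph_congr (iMarkovEquiv_glue hD hE)).symm⟩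

/-- The graphs that an undirected graph represents are its acyclic moral orientations. -/
theorem MEC_eq_orientations (G : SimpleGraph V) : MEC G = orientations G := by
  ext D
  constructor
  · rintro ⟨hD, h⟩
    rw [essentialGraph_eq] at h
    have hadj : ∀ a b, G.Adj a b ↔ ∃ D', (IsDAG D' ∧ IMarkovEquiv ∅ D D') ∧ D'.Adj a b := by
      intro a b
      rw [← iEssentialGraph_adj, h]
      rfl
    have hself : ∀ {a b}, D.Adj a b → G.Adj a b := fun e =>
      (hadj _ _).2 ⟨D, ⟨hD, fun X _ P => Iff.rfl⟩, e⟩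
    refine ⟨hD, fun a b c hac hbc hab => ?_, fun a b => ⟨fun e => ?_, fun e => ?_⟩⟩
    · by_contra hn
      push Not at hn
      obtain ⟨D', ⟨hD', h'⟩, e⟩ := (hadj c a).1 (hself hac).symm
      exact h'.not_adj_of_collider hD hD' hac hbc hab hn.1 hn.2 e
    · obtain ⟨D', ⟨hD', h'⟩, e⟩ := (hadj a b).1 e
      exact (h'.sameSkeleton hD hD' a b).2 (Or.inl e)
    · exact e.elim hself fun e => (hself e).symm
  · intro hD
    refine ⟨hD.1, ?_⟩
    rw [essentialGraph_eq]
    -- Every derivation of a forced edge starts from a cut edge, and without interventions there are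
    -- none.
    have hnot : ∀ a b, ¬ Forced ∅ D a b := by
      intro a b h
      induction h with
      | cut I _ hI _ => exact hI
      | away _ _ _ _ ih => exact ih
      | chain _ _ _ ih _ => exact ih
    ext a b
    rw [iEssentialGraph_adj_iff hD]
    constructor
    · exact fun h => (hD.2.2 a b).2 (h.resolve_left (hnot a b)).1.2
    · exact fun h => Or.inr ⟨⟨h.ne, (hD.2.2 a b).1 h⟩, hnot a b, hnot b a⟩

end Essential

/-! ### Counting -/

section Counting

variable {V : Type u}

/-- The orientations of a graph correspond to the families of orientations of its components. -/
def orientationsEquiv (H : SimpleGraph V) :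
    orientations H ≃ ∀ C : H.ConnectedComponent, orientations (H.induce C.supp) where
  toFun D C := ⟨⟨fun a b => D.1.Adj a b⟩, by
    obtain ⟨h1, h2, h3⟩ := D.2
    refine ⟨fun v hv => h1 v (Relation.TransGen.lift Subtype.val (fun _ _ e => e) _ _ hv),
      fun a b c hac hbc hab => h2 a b c hac hbc fun e => hab (Subtype.ext e),
      fun a b => h3 a b⟩⟩
  invFun E := ⟨⟨fun a b => ∃ (C : H.ConnectedComponent) (ha : a ∈ C.supp) (hb : b ∈ C.supp),
      (E C).1.Adj ⟨a, ha⟩ ⟨b, hb⟩⟩, by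
    have huniq : ∀ {C C' : H.ConnectedComponent} {a : V}, a ∈ C.supp → a ∈ C'.supp → C = C' :=
      fun h h' => ((SimpleGraph.ConnectedComponent.mem_supp_iff _ _).1 h).symm.trans
        ((SimpleGraph.ConnectedComponent.mem_supp_iff _ _).1 h')
    refine ⟨fun v hv => ?_, fun a b c hac hbc hab => ?_, fun a b => ⟨fun h => ?_, ?_⟩⟩
    · have key : ∀ {x y}, Relation.TransGen (fun a b => ∃ (C : H.ConnectedComponent)
          (ha : a ∈ C.supp) (hb : b ∈ C.supp), (E C).1.Adj ⟨a, ha⟩ ⟨b, hb⟩) x y →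
          ∃ (C : H.ConnectedComponent) (hx : x ∈ C.supp) (hy : y ∈ C.supp),
            Relation.TransGen (E C).1.Adj ⟨x, hx⟩ ⟨y, hy⟩ := by
        intro x y h
        induction h with
        | single e =>
          obtain ⟨C, ha, hb, e⟩ := e
          exact ⟨C, ha, hb, .single e⟩
        | tail _ e ih =>
          obtain ⟨C, hx, hy, t⟩ := ih
          obtain ⟨C', ha, hb, e⟩ := e
          obtain rfl := huniq hy ha
          exact ⟨C, hx, hb, t.tail e⟩
      obtain ⟨C, hx, hy, t⟩ := key hv
      exact (E C).2.1 _ t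
    · obtain ⟨C, ha, hc, e⟩ := hac
      obtain ⟨C', hb, hc', e'⟩ := hbc
      obtain rfl := huniq hc hc'
      exact ((E C).2.2.1 _ _ _ e e' fun e => hab (congrArg Subtype.val e)).imp
        (fun e => ⟨C, ha, hb, e⟩) fun e => ⟨C, hb, ha, e⟩
    · have ha : a ∈ (H.connectedComponentMk a).supp := rfl
      have hb : b ∈ (H.connectedComponentMk a).supp :=
        (SimpleGraph.ConnectedComponent.mem_supp_iff _ _).2
          (SimpleGraph.ConnectedComponent.sound h.symm.reachable)
      exact (((E _).2.2.2 ⟨a, ha⟩ ⟨b, hb⟩).1 h).imp (fun e => ⟨_, ha, hb, e⟩)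
        fun e => ⟨_, hb, ha, e⟩
    · rintro (⟨C, ha, hb, e⟩ | ⟨C, hb, ha, e⟩)
      · exact ((E C).2.2.2 ⟨a, ha⟩ ⟨b, hb⟩).2 (Or.inl e)
      · exact ((E C).2.2.2 ⟨a, ha⟩ ⟨b, hb⟩).2 (Or.inr e)⟩
  left_inv D := by
    ext a b
    refine ⟨fun ⟨C, ha, hb, e⟩ => e, fun e => ⟨H.connectedComponentMk a, rfl, ?_, e⟩⟩
    exact (SimpleGraph.ConnectedComponent.mem_supp_iff _ _).2
      (SimpleGraph.ConnectedComponent.sound ((D.2.2.2 a b).2 (Or.inl e)).symm.reachable)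
  right_inv E := by
    funext C
    ext ⟨a, ha⟩ ⟨b, hb⟩
    refine ⟨fun ⟨C', ha', hb', e⟩ => ?_, fun e => ⟨C, ha, hb, e⟩⟩
    obtain rfl : C' = C := ((SimpleGraph.ConnectedComponent.mem_supp_iff _ _).1 ha').symm.trans
        ((SimpleGraph.ConnectedComponent.mem_supp_iff _ _).1 ha)
    exact e

variable [Finite V]

theorem ncard_orientations (H : SimpleGraph V) :
    (orientations H).ncard
      = ∏ᶠ C : H.ConnectedComponent, (orientations (H.induce C.supp)).ncard := by
  have := Fintype.ofFinite H.ConnectedComponent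
  rw [finprod_eq_prod_of_fintype, ← Nat.card_coe_set_eq, Nat.card_congr (orientationsEquiv H),
    Nat.card_pi]
  rfl

instance : Finite (Digraph V) := by
  classical
  have := Fintype.ofFinite V
  infer_instance

end Counting

end Causal

/-! ### The counting formula -/

theorem lemma1 {V : Type*} [Finite V] (G : SimpleGraph V) (hG : Causal.IsChordal G)
    (𝓘 : Set (Set V)) :
    (Causal.MEC G).ncard =
      ∑ᶠ R ∈ Causal.interventionResults 𝓘 G,
        ∏ᶠ C : Causal.ChainComponent R, (Causal.MEC C.graph).ncard := by
  classical
  simp only [Causal.interventionResults, Causal.MEC_eq_orientations, Causal.ChainComponent.graph]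
  obtain ⟨s, hs⟩ := (Causal.orientations G).toFinite.exists_finset_coe
  -- The orientations are counted fibre by fibre over their `𝓘`-essential graphs.
  rw [← hs, ← Finset.coe_image, finsum_mem_coe_finset, Set.ncard_coe_finset,
    Finset.card_eq_sum_card_image (Causal.iEssentialGraph 𝓘) s]
  refine Finset.sum_congr rfl fun R hR => ?_
  obtain ⟨D, hD, rfl⟩ := Finset.mem_image.1 hR
  have hD' : D ∈ Causal.orientations G := hs ▸ Finset.mem_coe.2 hD
  rw [← Causal.ncard_orientations, ← Causal.ncard_iEssentialGraph_fiber hD',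
    ← Set.ncard_coe_finset]
  congr 1
  ext D''
  simp [← hs]
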